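/- Let $\mathbb E$ be a finite-dimensional complex vector space with a Hermitian metric, normalized so that its Kähler form is $\omega_{\mathbb E}=i\sum_j dz_j\wedge d\bar z_j$ in orthonormal complex coordinates. Let $\Gamma\subset\mathbb E$ be a discrete additive subgroup, $\Gamma_{\mathbb R}$ its real linear span, $\mathbb T=\mathbb E/\Gamma$, and $\pi:\mathbb E\to\mathbb T$ the projection. Write $\mathbb D^*=\{0<|x|<1\}$ and $\overline{\mathbb D}^*=\{0<|x|\le 1\}$. Let $f:\overline{\mathbb D}^*\to\mathbb E$ be a smooth map which is holomorphic on $\mathbb D^*$, has polynomial growth at $0$ (that is, $\|f(x)\|=O(|x|^{-N})$ as $x\to0$ for some integer $N$) and is not bounded. Then there are an integer $k\ge1$, integers $d_1>\dots>d_k>d_{k+1}=0$ and vectors $v_1,\dots,v_{k+1}\in\mathbb E$, with $v_1,\dots,v_k$ linearly independent over $\mathbb C$, such that, as $x\to0$, $$f(x)=(1+O(x))\,x^{-d_1}v_1+\dots+(1+O(x))\,x^{-d_k}v_k+v_{k+1}+O(x).$$ For every such choice put $d=d_1$, let $\mathbb F_k$ be the complex span of $v_1,\dots,v_k$, and let $V=\mathbb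 F_k+v_{k+1}$. Then $\mathbb F_k\subset\Gamma_{\mathbb R}$ if and only if $\overline{\pi(V)}$ is a translate of a compact real subtorus of $\mathbb T$ (i.e. is of the form $\pi(c+W)$, where $c\in\mathbb E$ and $W$ is a real vector subspace of $\mathbb E$ spanned over $\mathbb R$ by $\Gamma\cap W$). Suppose that $\mathbb F_k\subset\Gamma_{\mathbb R}$. Then: 1. There is a unique Haar probability measure $\mu_V$ on $\overline{\pi(V)}$, i.e. a unique Borel probability measure on $\mathbb T$ carried by $\overline{\pi(V)}$ and invariant under all translations of $\mathbb T$ that preserve $\overline{\pi(V)}$. For every non-empty connected open set $U$ whose closure is contained in $\mathbb D^*$, put $U_a=aU$ and $$\lambda_0=d^2\|v_1\|^2\int_U|x|^{-2d-2}\,(i\,dx\wedge d\bar x),\qquad \mu_a=\lambda_0^{-1}|a|^{2d}\,\pi_*\big(f_*[U_a]\wedge\omega_{\mathbb E}\big),$$ where $f_*[U_a]\wedge\omega_{\mathbb E}$ is the positive measure $\varphi\mapsto\int_{U_a}(\varphi\circ f)\,f^*\omega_{\mathbb E}$. Then $\mu_a$ converges weakly to $\mu_V$ as $a\to0$ in $\mathbb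 C\setminus\{0\}$, i.e. $\int g\,d\mu_a\to\int g\,d\mu_V$ for every bounded continuous $g:\mathbb T\to\mathbb R$. 2. The set $\Lambda_f$ of cluster values of $\pi(f(x))$ as $x\to0$ equals $\overline{\pi(V)}$. 3. $\overline{\pi(f(\mathbb D^*))}=\pi(f(\overline{\mathbb D}^*))\cup\overline{\pi(V)}$. -/

import Mathlib

open MeasureTheory Filter Topology Asymptotics
open scoped ContDiff BoundedContinuousFunction

noncomputable section

namespace OneDimFlow

/-- The punctured open unit disc `𝔻*`. -/
def puncturedDisc : Set ℂ := {x | x ≠ 0 ∧ ‖x‖ < 1}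

/-- The punctured closed unit disc. -/
def closedPuncturedDisc : Set ℂ := {x | x ≠ 0 ∧ ‖x‖ ≤ 1}

variable {E : Type*} [NormedAddCommGroup E] [InnerProductSpace ℂ E]

/-- `f` has polynomial growth at `0`: `‖f x‖ = O(|x| ^ (-N))` as `x → 0`, for some integer `N`. -/
def HasPolynomialGrowth (f : ℂ → E) : Prop :=
  ∃ N : ℤ, f =O[𝓝[≠] (0 : ℂ)] fun x => x ^ (-N)

/-- The data `k`, `d₁ > ⋯ > d_k > d_{k+1} = 0`, `v₁, …, v_{k+1}` (only the indices
`1, …, k + 1` of the sequences `d` and `v` are used), with `v₁, …, v_k` linearly independent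
over `ℂ`, form an expansion
`f(x) = (1 + O(x)) x^{-d₁} v₁ + ⋯ + (1 + O(x)) x^{-d_k} v_k + v_{k+1} + O(x)` as `x → 0`. -/
structure IsExpansion (f : ℂ → E) (k : ℕ) (d : ℕ → ℕ) (v : ℕ → E) : Prop where
  one_le : 1 ≤ k
  strictAnti : StrictAntiOn d (Set.Icc 1 (k + 1))
  last : d (k + 1) = 0
  linearIndep : LinearIndepOn ℂ v (Set.Icc 1 k)
  expansion : ∃ (h : ℕ → ℂ → ℂ) (r : ℂ → E),
    (∀ j ∈ Finset.Icc 1 k, h j =O[𝓝[≠] (0 : ℂ)] fun x => x) ∧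
    r =O[𝓝[≠] (0 : ℂ)] (fun x => x) ∧
    ∀ᶠ x in 𝓝[≠] (0 : ℂ),
      f x = ∑ j ∈ Finset.Icc 1 k, ((1 + h j x) * (x ^ d j)⁻¹) • v j + v (k + 1) + r x

/-- The complex span `𝔽_l` of `v₁, …, v_l`. -/
def flag (v : ℕ → E) (l : ℕ) : Submodule ℂ E := Submodule.span ℂ (v '' Set.Icc 1 l)

/-- The affine space `V = 𝔽_k + v_{k+1}`. -/
def affineV (v : ℕ → E) (k : ℕ) : AffineSubspace ℂ E :=
  AffineSubspace.mk' (v (k + 1)) (flag v k)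

/-- The Kähler form `ω_𝔼` of the Hermitian metric of `E`. In orthonormal complex coordinates it
is `i ∑ dz_j ∧ dz̄_j`. -/
def kahlerForm (u w : E) : ℝ := 2 * (inner ℂ u w).im

/-- The pullback `f^* ω_𝔼 = pullbackDensity f x · dx₁ ∧ dx₂`, where `x = x₁ + i x₂`. -/
def pullbackDensity (f : ℂ → E) (x : ℂ) : ℝ :=
  kahlerForm (fderiv ℝ f x 1) (fderiv ℝ f x Complex.I)

/-- The positive measure `f_*[W] ∧ ω_𝔼` on `E`, that is `φ ↦ ∫_W (φ ∘ f) f^* ω_𝔼`. -/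
def areaMeasure [MeasurableSpace E] (f : ℂ → E) (W : Set ℂ) : Measure E :=
  ((volume.restrict W).withDensity fun x => ENNReal.ofReal (pullbackDensity f x)).map f

/-- `λ₀ = d² ‖v₁‖² ∫_U |x|^{-2d-2} (i dx ∧ dx̄)`; recall that `i dx ∧ dx̄` is twice the
Lebesgue measure. -/
def lambdaZero (U : Set ℂ) (d : ℕ) (v₁ : E) : ℝ :=
  (d : ℝ) ^ 2 * ‖v₁‖ ^ 2 * ∫ x in U, (‖x‖ ^ (2 * d + 2))⁻¹ * 2

/-- The canonical projection `π : 𝔼 → 𝕋 = 𝔼 / Γ`. -/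
def proj (Γ : AddSubgroup E) : E → E ⧸ Γ := fun z => (z : E ⧸ Γ)

/-- The normalized measure `μ_a = λ₀⁻¹ |a|^{2d} π_*(f_*[aU] ∧ ω_𝔼)` on `𝕋`. -/
def mu [MeasurableSpace E] (Γ : AddSubgroup E) (f : ℂ → E) (d : ℕ) (v₁ : E) (U : Set ℂ) (a : ℂ) :
    Measure (E ⧸ Γ) :=
  ENNReal.ofReal ((lambdaZero U d v₁)⁻¹ * ‖a‖ ^ (2 * d)) •
    (areaMeasure f ((fun x => a * x) '' U)).map (proj Γ)

/-- The real span `Γ_ℝ` of `Γ`. -/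
def realSpan (Γ : AddSubgroup E) : Submodule ℝ E := Submodule.span ℝ (Γ : Set E)

/-- `S` is a translate of a compact real subtorus of `𝕋`: `S = π(c + W)`, where `W` is a real
vector subspace of `E` in which `Γ ∩ W` is a lattice of full rank. -/
def IsTranslatedSubtorus (Γ : AddSubgroup E) (S : Set (E ⧸ Γ)) : Prop :=
  ∃ (c : E) (W : Submodule ℝ E),
    W = Submodule.span ℝ ((Γ : Set E) ∩ W) ∧ S = proj Γ '' (AffineSubspace.mk' c W : Set E)

/-- The Haar probability measure on a translate `S` of a compact subgroup of `T`: the Borel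
probability measure on `T` carried by `S` and invariant under all the translations of `T`
that preserve `S` (if `S = c + H`, these are the translations by the elements of `H`). -/
structure IsHaarProbabilityOn {T : Type*} [AddCommGroup T] [MeasurableSpace T]
    (ν : Measure T) (S : Set T) : Prop where
  prob : IsProbabilityMeasure ν
  carried : ν Sᶜ = 0
  invariant : ∀ t : T, (fun s => t + s) '' S = S → ν.map (fun s => t + s) = ν

/-- The set `Λ_f` of cluster values of `π (f x)` as `x → 0`. -/
def clusterSet (Γ : AddSubgroup E) (f : ℂ → E) : Set (E ⧸ Γ) :=
  {t | MapClusterPt t (𝓝[≠] (0 : ℂ)) fun x => proj Γ (f x)}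

end OneDimFlow

end

/-! The proof is Weyl's equidistribution criterion for a holomorphic curve with a pole. Assume `𝔽_k
⊆ Γ_ℝ` and let `W ⊇ 𝔽_k` be a minimal real subspace spanned by `Γ ∩ W`. A basis of `W` taken in `Γ`
parametrizes `π(v_{k+1} + W)` by a torus `(ℝ/ℤ)^m`, and `f - v_{k+1}` lies in `W` up to `o(1)`, so
`π ∘ f` is asymptotic to a curve on that torus.

A non-trivial character of this curve is `exp (2πi Re Q)`, where `Q` is a complex linear functional
applied to `f - v_{k+1}`. By minimality of `W` the functional is non-zero on `𝔽_k`, hence `Q` has a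
genuine pole (`exists_rational_frame`, `exists_character_pole`). Then `1/Q'` vanishes to order at
least two at `0`, and one integration by parts shows that the averages of the character over `aU`
tend to `0` (`integral_phase_mul_eq`, `tendsto_setIntegral_phase_mul`). Density of trigonometric
polynomials gives equidistribution against any `C¹` weight (`tendsto_setIntegral_torus`).

For the measures `μ_a`, the substitution `x = a y` turns the area density into `2 ‖a^{d+1} f'(a
y)‖²`, which tends to `2 d² ‖v₁‖² |y|^{-2d-2}` with domination on `U`; this is the weight.
Equidistribution also forces the cluster values to fill the torus. Since they lie in the closure of
`π(V)`, which is itself contained in the torus, all three sets coincide: the density of `π(V)` is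
read off from `f`.

Conversely, if `π(V)` lies in `π(c + W)`, countability of `Γ` gives `𝔽_k ⊆ W`. The expansion itself
comes from the Laurent polar part, by keeping, from the highest order down, the coefficients
independent of those already kept. -/

namespace OneDimFlow

/-! ### Oscillatory integrals with a holomorphic phase -/

/-- The phase `exp (2 π i Re Q)`. -/
noncomputable def phase (Q : ℂ → ℂ) (x : ℂ) : ℂ :=
  Complex.exp (2 * Real.pi * Complex.I * ((Q x).re : ℂ))

theorem norm_phase (Q : ℂ → ℂ) (x : ℂ) : ‖phase Q x‖ = 1 := by
  have : (2 * Real.pi * Complex.I * ((Q x).re : ℂ)) =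
      ((2 * Real.pi * (Q x).re : ℝ) : ℂ) * Complex.I := by
    push_cast; ring
  rw [phase, this, Complex.norm_exp_ofReal_mul_I]

theorem hasLineDerivAt_phase {Q : ℂ → ℂ} {a y v q : ℂ} (hQ : HasDerivAt Q q (a * y)) :
    HasLineDerivAt ℝ (fun y => phase Q (a * y))
      (phase Q (a * y) * (2 * Real.pi * Complex.I * ((q * (a * v)).re : ℂ))) y v := by
  unfold HasLineDerivAt
  have h1 : HasDerivAt (fun t : ℝ => a * (y + t • v)) (a * v) 0 := by
    have : HasDerivAt (fun t : ℝ => y + t • v) ((1 : ℝ) • v) 0 :=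
      ((hasDerivAt_id (0 : ℝ)).smul_const v).const_add y
    simpa using this.const_mul a
  have h2 : HasDerivAt (fun t : ℝ => Q (a * (y + t • v))) (q * (a * v)) 0 := by
    have hQ' : HasDerivAt Q q (a * (y + (0 : ℝ) • v)) := by simpa using hQ
    exact hQ'.comp (0 : ℝ) h1
  have h3 := Complex.reCLM.hasFDerivAt.comp_hasDerivAt (0 : ℝ) h2
  have h4 := ((h3.ofReal_comp).const_mul (2 * Real.pi * Complex.I)).cexp
  simpa [phase] using h4

/-- Pairing the phase `exp (2 π i Re Q (a y))` with a test function, through one integration by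
parts along `∂`. -/
theorem integral_phase_mul_eq {Q S φ : ℂ → ℂ} {δ : ℝ} {a : ℂ}
    (hQ : DifferentiableOn ℂ Q {x | x ≠ 0 ∧ ‖x‖ < δ})
    (hS : DifferentiableOn ℂ S (Metric.ball 0 δ))
    (hSQ : ∀ x, x ≠ 0 → ‖x‖ < δ → S x * deriv Q x = 1)
    (hφ : ContDiff ℝ 1 φ) (hc : HasCompactSupport φ) (h0 : (0 : ℂ) ∉ tsupport φ)
    (ha : a ≠ 0) (haδ : ∀ y ∈ tsupport φ, ‖a * y‖ < δ) :
    -(2 * Real.pi * Complex.I) * ∫ y, phase Q (a * y) * φ y =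
      ∫ y, phase Q (a * y) * ((fderiv ℝ φ y 1 - Complex.I * fderiv ℝ φ y Complex.I) *
        (S (a * y) / a) + 2 * φ y * deriv S (a * y)) := by
  set K := tsupport φ with hK
  have hKc : IsCompact K := hc
  have hO : IsOpen {x : ℂ | x ≠ 0 ∧ ‖x‖ < δ} :=
    isOpen_ne.inter (isOpen_lt continuous_norm continuous_const)
  have hmap : Set.MapsTo (fun y => a * y) K {x : ℂ | x ≠ 0 ∧ ‖x‖ < δ} := fun y hy =>
    ⟨mul_ne_zero ha (fun h => h0 (h ▸ hy)), haδ y hy⟩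
  have hmap' : Set.MapsTo (fun y => a * y) K (Metric.ball (0 : ℂ) δ) := fun y hy => by
    simpa using haδ y hy
  have hcm : ContinuousOn (fun y : ℂ => a * y) K := by fun_prop
  have cQ : ContinuousOn (fun y => Q (a * y)) K := hQ.continuousOn.comp hcm hmap
  have cQ' : ContinuousOn (fun y => deriv Q (a * y)) K :=
    (hQ.deriv hO).continuousOn.comp hcm hmap
  have cS : ContinuousOn (fun y => S (a * y)) K := hS.continuousOn.comp hcm hmap'
  have cS' : ContinuousOn (fun y => deriv S (a * y)) K :=
    (hS.deriv Metric.isOpen_ball).continuousOn.comp hcm hmap'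
  have cre : ∀ u : ℂ → ℂ, ContinuousOn u K → ContinuousOn (fun y => ((u y).re : ℂ)) K :=
    fun u hu => (Complex.continuous_ofReal.comp Complex.continuous_re).comp_continuousOn hu
  have cP : ContinuousOn (fun y => phase Q (a * y)) K :=
    (continuousOn_const.mul (cre _ cQ)).cexp
  have cφ : ContinuousOn φ K := hφ.continuous.continuousOn
  have cφ' : ∀ v, ContinuousOn (fun y => fderiv ℝ φ y v) K := fun v =>
    ((hφ.continuous_fderiv (by norm_num)).clm_apply continuous_const).continuousOn
  have hφK : ∀ y, y ∉ K → φ y = 0 := fun y hy => image_eq_zero_of_notMem_tsupport hy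
  have hφK' : ∀ y, y ∉ K → fderiv ℝ φ y = 0 := fun y hy =>
    image_eq_zero_of_notMem_tsupport (fun h => hy (tsupport_fderiv_subset ℝ h))
  -- `Q (a * ·)` and `S (a * ·)` are controlled only on `K`, so integrability is obtained from
  -- continuity on `K` and vanishing outside it.
  have key : ∀ u : ℂ → ℂ, ContinuousOn u K → (∀ y, y ∉ K → u y = 0) → Integrable u := by
    intro u hu hu0
    rw [← integrableOn_iff_integrable_of_support_subset (s := K)]
    · exact hu.integrableOn_compact hKc
    · intro y hy; by_contra h; exact hy (hu0 y h)
  -- This is `φ` divided by the derivative `a * Q' (a y)` of `y ↦ Q (a y)`, which cancels the factor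
  -- produced by differentiating the phase.
  let g : ℂ → ℂ := fun y => φ y * (S (a * y) / a)
  let g' : ℂ → ℂ → ℂ := fun v y =>
    fderiv ℝ φ y v * (S (a * y) / a) + φ y * (deriv S (a * y) * v)
  let p' : ℂ → ℂ → ℂ := fun v y =>
    phase Q (a * y) * (2 * Real.pi * Complex.I * ((deriv Q (a * y) * (a * v)).re : ℂ))
  have hgK : tsupport g ⊆ K := closure_mono fun y hy => by
    intro h; exact hy (by simp [g, h])
  have hg : ∀ v y, HasLineDerivAt ℝ g (g' v y) y v := by
    intro v y
    by_cases hy : y ∈ K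
    · have h1 : HasFDerivAt φ (fderiv ℝ φ y) y := (hφ.differentiable (by norm_num) y).hasFDerivAt
      have h1' := h1.hasLineDerivAt v
      have h2 : HasDerivAt S (deriv S (a * y)) (a * y) :=
        (hS.differentiableAt (Metric.isOpen_ball.mem_nhds (hmap' hy))).hasDerivAt
      have h3 : HasDerivAt (fun t : ℝ => a * (y + t • v)) (a * v) 0 := by
        have : HasDerivAt (fun t : ℝ => y + t • v) ((1 : ℝ) • v) 0 :=
          ((hasDerivAt_id (0 : ℝ)).smul_const v).const_add y
        simpa using this.const_mul a
      have h4 : HasDerivAt (fun t : ℝ => S (a * (y + t • v))) (deriv S (a * y) * (a * v)) 0 := by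
        have h2' : HasDerivAt S (deriv S (a * y)) (a * (y + (0 : ℝ) • v)) := by simpa using h2
        exact h2'.comp (0 : ℝ) h3
      have h5 := HasDerivAt.mul h1' (h4.div_const a)
      unfold HasLineDerivAt
      have e0 : y + (0 : ℝ) • v = y := by simp
      have e1 : g' v y = fderiv ℝ φ y v * (S (a * (y + (0 : ℝ) • v)) / a) +
          φ (y + (0 : ℝ) • v) * (deriv S (a * y) * (a * v) / a) := by
        simp only [g', e0]
        field_simp
      rw [e1]
      exact h5
    · have h1 : g =ᶠ[𝓝 y] fun _ => 0 := by
        filter_upwards [hKc.isClosed.isOpen_compl.mem_nhds hy] with z hz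
        simp [g, hφK z hz]
      have h2 : HasFDerivAt g (0 : ℂ →L[ℝ] ℂ) y :=
        (hasFDerivAt_const (0 : ℂ) y).congr_of_eventuallyEq h1
      simpa [g', hφK y hy, hφK' y hy] using h2.hasLineDerivAt v
  have hp : ∀ v, ∀ y ∈ tsupport g, HasLineDerivAt ℝ (fun y => phase Q (a * y)) (p' v y) y v := by
    intro v y hy
    refine hasLineDerivAt_phase ?_
    exact (hQ.differentiableAt (hO.mem_nhds (hmap (hgK hy)))).hasDerivAt
  have hgc : ContinuousOn g K := cφ.mul (cS.div_const a)
  have hg'c : ∀ v, ContinuousOn (g' v) K := by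
    intro v
    exact ((cφ' v).mul (cS.div_const a)).add (cφ.mul (cS'.mul continuousOn_const))
  have hp'c : ∀ v, ContinuousOn (p' v) K := by
    intro v
    exact cP.mul (continuousOn_const.mul (cre _ (cQ'.mul continuousOn_const)))
  have hg0 : ∀ y, y ∉ K → g y = 0 := fun y hy => by simp [g, hφK y hy]
  have hg'0 : ∀ v, ∀ y, y ∉ K → g' v y = 0 := fun v y hy => by simp [g', hφK y hy, hφK' y hy]
  have i1 : ∀ v, Integrable (fun y => p' v y * g y) := fun v =>
    key _ ((hp'c v).mul hgc) (fun y hy => by simp [hg0 y hy])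
  have i2 : ∀ v, Integrable (fun y => phase Q (a * y) * g' v y) := fun v =>
    key _ (cP.mul (hg'c v)) (fun y hy => by simp [hg'0 v y hy])
  have i3 : Integrable (fun y => phase Q (a * y) * g y) :=
    key _ (cP.mul hgc) (fun y hy => by simp [hg0 y hy])
  have parts : ∀ v, ∫ y, phase Q (a * y) * g' v y = - ∫ y, p' v y * g y := fun v =>
    integral_bilinear_hasLineDerivAt_right_eq_neg_left_of_integrable
      (B := ContinuousLinearMap.mul ℝ ℂ) (i1 v) (i2 v) i3 (hp v) (fun y _ => hg v y)
  have e1 := parts 1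
  have e2 := parts Complex.I
  have lhs : ∫ y, (p' 1 y * g y - Complex.I * (p' Complex.I y * g y)) =
      (2 * Real.pi * Complex.I) * ∫ y, phase Q (a * y) * φ y := by
    rw [← integral_const_mul]
    congr 1
    funext y
    by_cases hy : y ∈ K
    · have h1 := hSQ (a * y) (hmap hy).1 (hmap hy).2
      -- `Re w - i Re (i w) = w`: the operator `∂₁ - i ∂_I` recovers the full holomorphic derivative
      -- from the real part alone.
      have h2 : ((deriv Q (a * y) * (a * 1)).re : ℂ) -
          Complex.I * ((deriv Q (a * y) * (a * Complex.I)).re : ℂ) = deriv Q (a * y) * a := by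
        rw [mul_one, ← mul_assoc]
        set w := deriv Q (a * y) * a
        apply Complex.ext <;> simp
      calc _ = phase Q (a * y) * φ y * (2 * Real.pi * Complex.I) * (S (a * y) / a) *
            (((deriv Q (a * y) * (a * 1)).re : ℂ) -
          Complex.I * ((deriv Q (a * y) * (a * Complex.I)).re : ℂ)) := by simp only [p', g]; ring
        _ = phase Q (a * y) * φ y * (2 * Real.pi * Complex.I) *
            (S (a * y) * deriv Q (a * y)) := by rw [h2]; field_simp
        _ = _ := by rw [h1]; ring
    · simp [hg0 y hy, hφK y hy]
  rw [neg_mul, ← lhs, integral_sub (i1 1) ((i1 Complex.I).const_mul _), integral_const_mul]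
  -- The same operator applied to the holomorphic `S` gives `S' - i (i S') = 2 S'`, whence the
  -- factor `2`.
  have rhs : (∫ y, phase Q (a * y) * ((fderiv ℝ φ y 1 - Complex.I * fderiv ℝ φ y Complex.I) *
        (S (a * y) / a) + 2 * φ y * deriv S (a * y))) =
      (∫ y, phase Q (a * y) * g' 1 y) - Complex.I * ∫ y, phase Q (a * y) * g' Complex.I y := by
    rw [← integral_const_mul, ← integral_sub (i2 1) ((i2 Complex.I).const_mul _)]
    congr 1
    funext y
    simp only [g']
    linear_combination phase Q (a * y) * φ y * deriv S (a * y) * Complex.I_mul_I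
  rw [rhs, e1, e2]
  ring

/-- After the integration by parts the phase has modulus one, and the remaining factors `S (a y) /
a` and `S' (a y)` tend to `0` uniformly on the support of `φ`, because `S` vanishes to second order
at `0`. -/
theorem tendsto_integral_phase_mul {Q S φ : ℂ → ℂ} {δ : ℝ} (hδ : 0 < δ)
    (hQ : DifferentiableOn ℂ Q {x | x ≠ 0 ∧ ‖x‖ < δ})
    (hS : DifferentiableOn ℂ S (Metric.ball 0 δ))
    (hSQ : ∀ x, x ≠ 0 → ‖x‖ < δ → S x * deriv Q x = 1)
    (hS0 : S 0 = 0) (hS0' : deriv S 0 = 0)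
    (hφ : ContDiff ℝ 1 φ) (hc : HasCompactSupport φ) (h0 : (0 : ℂ) ∉ tsupport φ) :
    Tendsto (fun a : ℂ => ∫ y, phase Q (a * y) * φ y) (𝓝[≠] 0) (𝓝 0) := by
  set K := tsupport φ with hK
  have hKc : IsCompact K := hc
  have hφK : ∀ y, y ∉ K → φ y = 0 := fun y hy => image_eq_zero_of_notMem_tsupport hy
  have hφK' : ∀ y, y ∉ K → fderiv ℝ φ y = 0 := fun y hy =>
    image_eq_zero_of_notMem_tsupport (fun h => hy (tsupport_fderiv_subset ℝ h))
  obtain ⟨R, hR0, hR⟩ : ∃ R : ℝ, 0 < R ∧ ∀ y ∈ K, ‖y‖ ≤ R := by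
    obtain ⟨R, hR⟩ := hKc.isBounded.exists_norm_le
    exact ⟨max R 1, by positivity, fun y hy => (hR y hy).trans (le_max_left _ _)⟩
  -- Majorant of the new integrand up to a factor `η`; `R` bounds `|y|` in `|S (a y) / a| ≤ η |y|`.
  let M : ℂ → ℝ := fun y => ‖fderiv ℝ φ y 1 - Complex.I * fderiv ℝ φ y Complex.I‖ * R + 2 * ‖φ y‖
  have cφ' : ∀ v, Continuous (fun y => fderiv ℝ φ y v) := fun v =>
    ((hφ.continuous_fderiv (by norm_num)).clm_apply continuous_const)
  have hM : Integrable M := by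
    apply Continuous.integrable_of_hasCompactSupport
    · have := cφ' 1
      have := cφ' Complex.I
      have := hφ.continuous
      fun_prop
    · refine HasCompactSupport.intro hKc fun y hy => by simp [M, hφK y hy, hφK' y hy]
  have hM0 : ∀ y, 0 ≤ M y := fun y => by positivity
  -- smallness of `S x / x` and `S' x`
  have hSd : HasDerivAt S 0 0 := by
    have := (hS.differentiableAt (Metric.ball_mem_nhds _ hδ)).hasDerivAt
    rwa [hS0'] at this
  have hS'c : ContinuousAt (deriv S) 0 :=
    ((hS.deriv Metric.isOpen_ball).continuousOn).continuousAt (Metric.ball_mem_nhds _ hδ)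
  rw [Metric.tendsto_nhds]
  intro ε hε
  have hI : 0 ≤ ∫ y, M y := integral_nonneg hM0
  have hη0 : 0 < ε / ((∫ y, M y) + 1) := by positivity
  set η : ℝ := ε / ((∫ y, M y) + 1) with hη
  have s1 : ∀ᶠ x in 𝓝 (0 : ℂ), ‖S x‖ ≤ η * ‖x‖ := by
    have := hSd.isLittleO.def hη0
    simpa [hS0] using this
  have s2 : ∀ᶠ x in 𝓝 (0 : ℂ), ‖deriv S x‖ ≤ η := by
    have h := hS'c.norm
    simp only [ContinuousAt, hS0', norm_zero] at h
    filter_upwards [h.eventually_lt_const hη0] with x hx using hx.le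
  obtain ⟨δ', hδ', hs⟩ := Metric.eventually_nhds_iff.1 (s1.and s2)
  have : ∀ᶠ a : ℂ in 𝓝[≠] 0, ‖a‖ * R < min δ δ' := by
    have : Tendsto (fun a : ℂ => ‖a‖ * R) (𝓝[≠] 0) (𝓝 0) := by
      have : Tendsto (fun a : ℂ => ‖a‖ * R) (𝓝 0) (𝓝 (‖(0 : ℂ)‖ * R)) :=
        (continuous_norm.mul continuous_const).tendsto 0
      simpa using this.mono_left nhdsWithin_le_nhds
    exact this.eventually_lt_const (lt_min hδ hδ')
  filter_upwards [this, self_mem_nhdsWithin] with a ha ha0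
  have ha0 : a ≠ 0 := ha0
  have haK : ∀ y ∈ K, ‖a * y‖ < min δ δ' := fun y hy => by
    rw [norm_mul]
    exact (mul_le_mul_of_nonneg_left (hR y hy) (norm_nonneg a)).trans_lt ha
  have e := integral_phase_mul_eq hQ hS hSQ hφ hc h0 ha0
    (fun y hy => (haK y hy).trans_le (min_le_left _ _))
  have b : ‖∫ y, phase Q (a * y) * ((fderiv ℝ φ y 1 - Complex.I * fderiv ℝ φ y Complex.I) *
        (S (a * y) / a) + 2 * φ y * deriv S (a * y))‖ ≤ ∫ y, η * M y := by
    refine norm_integral_le_of_norm_le (hM.const_mul η) (Eventually.of_forall fun y => ?_)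
    rw [norm_mul, norm_phase, one_mul]
    by_cases hy : y ∈ K
    · obtain ⟨h1, h2⟩ := hs (y := a * y)
        (by simpa using (haK y hy).trans_le (min_le_right _ _))
      have h1' : ‖S (a * y) / a‖ ≤ η * R := by
        rw [norm_div, div_le_iff₀ (norm_pos_iff.2 ha0)]
        refine h1.trans ?_
        rw [norm_mul]
        have := mul_le_mul_of_nonneg_left (hR y hy) (norm_nonneg a)
        nlinarith
      refine (norm_add_le _ _).trans ?_
      rw [norm_mul, norm_mul, norm_mul]
      have := mul_le_mul_of_nonneg_left h1'
        (norm_nonneg (fderiv ℝ φ y 1 - Complex.I * fderiv ℝ φ y Complex.I))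
      have := mul_le_mul_of_nonneg_left h2 (norm_nonneg (φ y))
      simp only [M, Complex.norm_ofNat]
      nlinarith
    · simp [hφK y hy, hφK' y hy, M]
  rw [← e, integral_const_mul, norm_mul] at b
  have hpi : (1 : ℝ) ≤ ‖-(2 * Real.pi * Complex.I : ℂ)‖ := by
    simp only [norm_neg, norm_mul, Complex.norm_ofNat, Complex.norm_real, Complex.norm_I, mul_one,
      Real.norm_eq_abs, abs_of_pos Real.pi_pos]
    linarith [Real.pi_gt_three]
  rw [dist_zero_right]
  have h1 : ‖∫ y, phase Q (a * y) * φ y‖ ≤ η * ∫ y, M y :=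
    le_trans (le_mul_of_one_le_left (norm_nonneg _) hpi) b
  refine h1.trans_lt ?_
  rw [hη, div_mul_eq_mul_div, div_lt_iff₀ (by positivity)]
  nlinarith

end OneDimFlow

/-! ### Holomorphic functions with a pole, and decay of one character -/

namespace OneDimFlow

theorem isOpen_puncturedDisc : IsOpen puncturedDisc :=
  isOpen_ne.inter (isOpen_lt continuous_norm continuous_const)

theorem puncturedDisc_subset : puncturedDisc ⊆ closedPuncturedDisc := fun _ hx => ⟨hx.1, hx.2.le⟩

theorem puncturedDisc_mem_nhdsNE : puncturedDisc ∈ 𝓝[≠] (0 : ℂ) := by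
  have : Metric.ball (0 : ℂ) 1 ∈ 𝓝[≠] (0 : ℂ) :=
    nhdsWithin_le_nhds (Metric.ball_mem_nhds _ one_pos)
  filter_upwards [this, self_mem_nhdsWithin] with x hx hx0 using ⟨hx0, by simpa using hx⟩

/-- A holomorphic function on the punctured disc whose product with `x ^ D` has a limit at `0` is
`x ^ (-D)` times a holomorphic function on the disc. -/
theorem exists_holomorphic_factor {E : Type*} [NormedAddCommGroup E] [NormedSpace ℂ E]
    [CompleteSpace E] {f : ℂ → E} {D : ℕ} {b : E} (hf : DifferentiableOn ℂ f puncturedDisc)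
    (hlim : Tendsto (fun x => x ^ D • f x) (𝓝[≠] 0) (𝓝 b)) :
    ∃ F : ℂ → E, DifferentiableOn ℂ F (Metric.ball 0 1) ∧ F 0 = b ∧
      (∀ x ∈ puncturedDisc, f x = (x ^ D)⁻¹ • F x) ∧
      ∀ x ∈ puncturedDisc, HasDerivAt f ((x ^ (D + 1))⁻¹ • (x • deriv F x - (D : ℂ) • F x)) x := by
  classical
  let F : ℂ → E := Function.update (fun x => x ^ D • f x) 0 b
  have hF : ∀ x, x ≠ 0 → F x = x ^ D • f x := fun x hx => Function.update_of_ne hx _ _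
  have hFd : DifferentiableOn ℂ F (Metric.ball 0 1) := by
    rw [← Complex.differentiableOn_compl_singleton_and_continuousAt_iff
      (Metric.ball_mem_nhds (0 : ℂ) one_pos)]
    constructor
    · have : DifferentiableOn ℂ (fun x => x ^ D • f x) (Metric.ball 0 1 \ {0}) :=
        (differentiableOn_id.pow D).smul (hf.mono fun x hx => ⟨hx.2, by simpa using hx.1⟩)
      exact this.congr fun x hx => hF x hx.2
    · exact continuousAt_update_same.2 hlim
  have hfF : ∀ x ∈ puncturedDisc, f x = (x ^ D)⁻¹ • F x := fun x hx => by
    rw [hF x hx.1, smul_smul, inv_mul_cancel₀ (pow_ne_zero _ hx.1), one_smul]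
  refine ⟨F, hFd, Function.update_self _ _ _, hfF, fun x hx => ?_⟩
  have h1 : HasDerivAt F (deriv F x) x :=
    (hFd.differentiableAt (Metric.isOpen_ball.mem_nhds (by simpa using hx.2))).hasDerivAt
  have h2 := ((hasDerivAt_pow D x).inv (pow_ne_zero D hx.1)).smul h1
  have h3 : f =ᶠ[𝓝 x] (fun x => (x ^ D)⁻¹ • F x) := by
    filter_upwards [isOpen_puncturedDisc.mem_nhds hx] with y hy using hfF y hy
  refine (h2.congr_of_eventuallyEq h3).congr_deriv ?_
  have hx0 := hx.1
  rw [smul_sub, smul_smul, smul_smul, sub_eq_add_neg, ← neg_smul]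
  congr 2
  · rw [Pi.inv_apply]; field_simp; ring
  · rcases D with _ | D
    · simp
    · simp only [Nat.add_sub_cancel]; field_simp; ring

/-- With `f = x^{-D} F` one has `x^{D+1} f' = x F' - D F`. Applied with `b = v₁`, this gives the
limit of the rescaled area density. -/
theorem tendsto_pow_smul_deriv {E : Type*} [NormedAddCommGroup E] [NormedSpace ℂ E]
    [CompleteSpace E] {f : ℂ → E} {D : ℕ} {b : E} (hf : DifferentiableOn ℂ f puncturedDisc)
    (hlim : Tendsto (fun x => x ^ D • f x) (𝓝[≠] 0) (𝓝 b)) :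
    Tendsto (fun x => x ^ (D + 1) • deriv f x) (𝓝[≠] 0) (𝓝 (-(D : ℂ) • b)) := by
  obtain ⟨F, hF, hF0, -, hd⟩ := exists_holomorphic_factor hf hlim
  have c1 : ContinuousAt F 0 := hF.continuousOn.continuousAt (Metric.ball_mem_nhds _ one_pos)
  have c2 : ContinuousAt (deriv F) 0 :=
    (hF.deriv Metric.isOpen_ball).continuousOn.continuousAt (Metric.ball_mem_nhds _ one_pos)
  have c3 : ContinuousAt (fun x => x • deriv F x - (D : ℂ) • F x) 0 :=
    (continuousAt_id.smul c2).sub (continuousAt_const.smul c1)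
  have := c3.tendsto.mono_left (nhdsWithin_le_nhds (s := {0}ᶜ))
  simp only [zero_smul, hF0, zero_sub, ← neg_smul] at this
  refine this.congr' ?_
  filter_upwards [puncturedDisc_mem_nhdsNE] with x hx
  rw [(hd x hx).deriv, smul_smul, mul_inv_cancel₀ (pow_ne_zero _ hx.1), one_smul]

/-- At a pole, the reciprocal of the derivative extends holomorphically with vanishing value and
derivative. -/
theorem exists_inv_deriv {Q : ℂ → ℂ} {D : ℕ} {b : ℂ} (hQ : DifferentiableOn ℂ Q puncturedDisc)
    (hD : D ≠ 0) (hb : b ≠ 0) (hlim : Tendsto (fun x => x ^ D * Q x) (𝓝[≠] 0) (𝓝 b)) :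
    ∃ (δ : ℝ) (S : ℂ → ℂ), 0 < δ ∧ δ ≤ 1 ∧ DifferentiableOn ℂ S (Metric.ball 0 δ) ∧
      (∀ x, x ≠ 0 → ‖x‖ < δ → S x * deriv Q x = 1) ∧ S 0 = 0 ∧ deriv S 0 = 0 := by
  obtain ⟨F, hF, hF0, -, hd⟩ := exists_holomorphic_factor hQ hlim
  have hF' := hF.deriv Metric.isOpen_ball
  -- Here `Q' = x^{-D-1} R` with `R 0 = -D b ≠ 0`, so `1/Q' = x^{D+1} / R` near `0`, and `D + 1 ≥
  -- 2`.
  let R : ℂ → ℂ := fun x => x * deriv F x - D * F x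
  have hR : DifferentiableOn ℂ R (Metric.ball 0 1) :=
    (differentiableOn_id.mul hF').sub (hF.const_mul _)
  have hR0 : R 0 ≠ 0 := by simp [R, hF0, hD, hb]
  have hRc : ContinuousAt R 0 := hR.continuousOn.continuousAt (Metric.ball_mem_nhds _ one_pos)
  obtain ⟨δ, hδ, hδR⟩ := Metric.eventually_nhds_iff.1 (hRc.eventually_ne hR0)
  have hR' : DifferentiableOn ℂ (fun x => (R x)⁻¹) (Metric.ball 0 (min δ 1)) :=
    (hR.mono (Metric.ball_subset_ball (min_le_right _ _))).inv
      fun x hx => hδR ((Metric.mem_ball.1 hx).trans_le (min_le_left _ _))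
  have hδ1 : 0 < min δ 1 := lt_min hδ one_pos
  refine ⟨min δ 1, fun x => x ^ (D + 1) * (R x)⁻¹, hδ1, min_le_right _ _,
    (differentiableOn_id.pow _).mul hR', ?_, by simp, ?_⟩
  · intro x hx hxδ
    have hxR : R x ≠ 0 := hδR (by simpa using hxδ.trans_le (min_le_left _ _))
    rw [(hd x ⟨hx, hxδ.trans_le (min_le_right _ _)⟩).deriv]
    simp only [smul_eq_mul]
    change x ^ (D + 1) * (R x)⁻¹ * ((x ^ (D + 1))⁻¹ * R x) = 1
    field_simp
  · have h1 : HasDerivAt (fun x => (R x)⁻¹) (deriv (fun x => (R x)⁻¹) 0) 0 :=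
      (hR'.differentiableAt (Metric.ball_mem_nhds _ hδ1)).hasDerivAt
    have h2 := (hasDerivAt_pow (D + 1) (0 : ℂ)).mul h1
    have h3 := h2.deriv
    simp only [ne_eq, hD, not_false_eq_true, zero_pow, add_tsub_cancel_right, mul_zero, zero_mul,
      Nat.add_eq_zero_iff, add_zero, one_ne_zero, and_false] at h3
    exact h3

theorem isCompact_closure_of_subset {U : Set ℂ} (hU : closure U ⊆ puncturedDisc) :
    IsCompact (closure U) :=
  Metric.isCompact_of_isClosed_isBounded isClosed_closure
    ((Metric.isBounded_ball (x := (0 : ℂ)) (r := 1)).subset fun x hx => by simpa using (hU hx).2)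

theorem mul_mem_puncturedDisc {a y : ℂ} (ha : a ∈ puncturedDisc) (hy : y ∈ puncturedDisc) :
    a * y ∈ puncturedDisc := by
  refine ⟨mul_ne_zero ha.1 hy.1, ?_⟩
  rw [norm_mul]
  exact mul_lt_one_of_nonneg_of_lt_one_left (norm_nonneg _) ha.2 hy.2.le

/-- Smooth cut-offs increasing to the indicator of an open set. -/
theorem exists_smooth_cutoff {U : Set ℂ} (hU : IsOpen U) :
    ∃ χ : ℕ → ℂ → ℝ, (∀ n, ContDiff ℝ 1 (χ n)) ∧ (∀ n y, y ∉ U → χ n y = 0) ∧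
      (∀ n y, χ n y ∈ Set.Icc (0 : ℝ) 1) ∧
      ∀ y ∈ U, Tendsto (fun n => χ n y) atTop (𝓝 1) := by
  obtain ⟨u, hu, hud, hur⟩ := hU.exists_contDiff_support_eq (n := 1)
  refine ⟨fun n y => Real.smoothTransition (n * u y), fun n => ?_, fun n y hy => ?_,
    fun n y => ⟨Real.smoothTransition.nonneg _, Real.smoothTransition.le_one _⟩, fun y hy => ?_⟩
  · exact (Real.smoothTransition.contDiff (n := 1)).comp (contDiff_const.mul (by exact_mod_cast hud))
  · have : u y = 0 := by rw [← hu] at hy; simpa using hy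
    simp [this]
  · have h0 : u y ≠ 0 := by rw [← hu] at hy; simpa using hy
    have h1 : 0 < u y := lt_of_le_of_ne (hur ⟨y, rfl⟩).1 h0.symm
    refine tendsto_const_nhds.congr' ?_
    filter_upwards [(tendsto_natCast_atTop_atTop.atTop_mul_const h1).eventually_ge_atTop 1]
      with n hn
    exact (Real.smoothTransition.one_of_one_le hn).symm

/-- Equidistribution at the level of one non-trivial character. -/
theorem tendsto_setIntegral_phase_mul {Q : ℂ → ℂ} {D : ℕ} {b : ℂ}
    (hQ : DifferentiableOn ℂ Q puncturedDisc) (hD : D ≠ 0) (hb : b ≠ 0)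
    (hlim : Tendsto (fun x => x ^ D * Q x) (𝓝[≠] 0) (𝓝 b))
    {U : Set ℂ} (hU : IsOpen U) (hUD : closure U ⊆ puncturedDisc) {ρ : ℂ → ℂ}
    (hρ : ContDiffOn ℝ 1 ρ {0}ᶜ) :
    Tendsto (fun a : ℂ => ∫ y in U, phase Q (a * y) * ρ y) (𝓝[≠] 0) (𝓝 0) := by
  obtain ⟨δ, S, hδ, hδ1, hS, hSQ, hS0, hS0'⟩ := exists_inv_deriv hQ hD hb hlim
  obtain ⟨χ, hχ, hχU, hχI, hχlim⟩ := exists_smooth_cutoff hU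
  have hK := isCompact_closure_of_subset hUD
  have hρc : ContinuousOn ρ (closure U) := hρ.continuousOn.mono fun x hx => (hUD hx).1
  have hρi : IntegrableOn ρ U := (hρc.integrableOn_compact hK).mono_set subset_closure
  let φ : ℕ → ℂ → ℂ := fun n y => χ n y * ρ y
  have hφt : ∀ n, tsupport (φ n) ⊆ closure U := fun n => closure_mono fun y hy => by
    by_contra h
    exact hy (by simp [φ, hχU n y h])
  have hφc : ∀ n, HasCompactSupport (φ n) := fun n => hK.of_isClosed_subset
    (isClosed_tsupport _) (hφt n)
  have hφ0 : ∀ n, (0 : ℂ) ∉ tsupport (φ n) := fun n h => (hUD (hφt n h)).1 rfl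
  have hφd : ∀ n, ContDiff ℝ 1 (φ n) := fun n => by
    rw [contDiff_iff_contDiffAt]
    intro y
    by_cases hy : y ∈ tsupport (φ n)
    swap
    · exact contDiffAt_const.congr_of_eventuallyEq (notMem_tsupport_iff_eventuallyEq.1 hy)
    have hy0 : y ∈ ({0}ᶜ : Set ℂ) := fun h => hφ0 n (by rwa [← Set.mem_singleton_iff.1 h])
    have h1 : ContDiff ℝ 1 (fun y => (χ n y : ℂ)) := Complex.ofRealCLM.contDiff.comp (hχ n)
    exact h1.contDiffAt.mul (hρ.contDiffAt (isOpen_compl_singleton.mem_nhds hy0))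
  have hφi : ∀ n, Integrable (φ n) := fun n =>
    (hφd n).continuous.integrable_of_hasCompactSupport (hφc n)
  -- Since the phase has modulus one, this `L¹` error bounds the cost of the cut-off for all small
  -- `a` at once; `n` can be fixed before `a → 0`.
  have err : Tendsto (fun n => ∫ y in U, ‖ρ y - φ n y‖) atTop (𝓝 0) := by
    have : Tendsto (fun n => ∫ y in U, ‖ρ y - φ n y‖) atTop (𝓝 (∫ y in U, (0 : ℝ))) := by
      refine tendsto_integral_of_dominated_convergence (fun y => ‖ρ y‖) (fun n => ?_)
        hρi.norm (fun n => ?_) ?_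
      · exact ((hρi.sub (hφi n).integrableOn).norm).aestronglyMeasurable
      · refine Eventually.of_forall fun y => ?_
        have : ρ y - φ n y = ((1 - χ n y : ℝ) : ℂ) * ρ y := by simp [φ]; ring
        rw [this, norm_norm, norm_mul, Complex.norm_real, Real.norm_eq_abs,
          abs_of_nonneg (by linarith [(hχI n y).2])]
        exact mul_le_of_le_one_left (norm_nonneg _) (by linarith [(hχI n y).1])
      · filter_upwards [ae_restrict_mem hU.measurableSet] with y hy
        have h1 : Tendsto (fun n => (χ n y : ℂ)) atTop (𝓝 ((1 : ℝ) : ℂ)) :=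
          (Complex.continuous_ofReal.tendsto _).comp (hχlim y hy)
        have h2 := (tendsto_const_nhds (x := ρ y)).sub (h1.mul_const (ρ y))
        simpa using h2.norm
    simpa using this
  rw [Metric.tendsto_nhds]
  intro ε hε
  obtain ⟨n, hn⟩ := (err.eventually_lt_const (half_pos hε)).exists
  have hQδ : DifferentiableOn ℂ Q {x | x ≠ 0 ∧ ‖x‖ < δ} :=
    hQ.mono fun x hx => ⟨hx.1, hx.2.trans_le hδ1⟩
  have main := tendsto_integral_phase_mul hδ hQδ hS hSQ hS0 hS0' (hφd n) (hφc n) (hφ0 n)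
  filter_upwards [(Metric.tendsto_nhds.1 main) _ (half_pos hε), puncturedDisc_mem_nhdsNE]
    with a ha haD
  rw [dist_zero_right] at ha ⊢
  have e1 : ∫ y, phase Q (a * y) * φ n y = ∫ y in U, phase Q (a * y) * φ n y := by
    refine (setIntegral_eq_integral_of_forall_compl_eq_zero fun y hy => ?_).symm
    simp [φ, hχU n y hy]
  have hm : AEStronglyMeasurable (fun y => phase Q (a * y)) (volume.restrict U) := by
    refine ContinuousOn.aestronglyMeasurable ?_ hU.measurableSet
    have : ContinuousOn (fun y => Q (a * y)) U := hQ.continuousOn.comp (by fun_prop)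
      fun y hy => mul_mem_puncturedDisc haD (hUD (subset_closure hy))
    exact (continuousOn_const.mul ((Complex.continuous_ofReal.comp
      Complex.continuous_re).comp_continuousOn this)).cexp
  have hbd : ∀ᵐ y ∂(volume.restrict U), ‖phase Q (a * y)‖ ≤ 1 :=
    Eventually.of_forall fun y => (norm_phase _ _).le
  have j1 : IntegrableOn (fun y => phase Q (a * y) * ρ y) U := hρi.bdd_mul hm hbd
  have j2 : IntegrableOn (fun y => phase Q (a * y) * φ n y) U :=
    (hφi n).integrableOn.bdd_mul hm hbd
  have e2 : ‖(∫ y in U, phase Q (a * y) * ρ y) - ∫ y in U, phase Q (a * y) * φ n y‖ ≤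
      ∫ y in U, ‖ρ y - φ n y‖ := by
    rw [← integral_sub j1 j2]
    refine (norm_integral_le_integral_norm _).trans_eq ?_
    congr 1
    funext y
    rw [← mul_sub, norm_mul, norm_phase, one_mul]
  rw [← e1] at e2
  have := norm_add_le ((∫ y in U, phase Q (a * y) * ρ y) - ∫ y, phase Q (a * y) * φ n y)
    (∫ y, phase Q (a * y) * φ n y)
  rw [sub_add_cancel] at this
  linarith

end OneDimFlow

/-! ### Expansions at the pole: leading terms and existence -/

namespace OneDimFlow

variable {E : Type*} [NormedAddCommGroup E] [InnerProductSpace ℂ E]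

/-- Once `L` kills the terms of higher order, the `i`-th one dominates. Used for the identity with
`i = 1`, and for functionals, where `L (v i) ≠ 0` yields a pole of exact order `d i`. -/
theorem IsExpansion.tendsto_pow_smul {f : ℂ → E} {k : ℕ} {d : ℕ → ℕ} {v : ℕ → E}
    (he : IsExpansion f k d v) {F : Type*} [NormedAddCommGroup F] [NormedSpace ℂ F]
    (L : E →L[ℂ] F) {i : ℕ} (hi : i ∈ Finset.Icc 1 k)
    (hL : ∀ j ∈ Finset.Icc 1 k, j < i → L (v j) = 0) :
    Tendsto (fun x => x ^ d i • L (f x - v (k + 1))) (𝓝[≠] 0) (𝓝 (L (v i))) := by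
  obtain ⟨h, r, hh, hr, hf⟩ := he.expansion
  have hid : Tendsto (fun x : ℂ => x) (𝓝[≠] 0) (𝓝 0) := nhdsWithin_le_nhds
  have hr0 : Tendsto r (𝓝[≠] 0) (𝓝 0) := hr.trans_tendsto hid
  have hh0 : ∀ j ∈ Finset.Icc 1 k, Tendsto (h j) (𝓝[≠] 0) (𝓝 0) := fun j hj =>
    (hh j hj).trans_tendsto hid
  have hterm : ∀ j ∈ Finset.Icc 1 k,
      Tendsto (fun x => ((1 + h j x) * (x ^ d i * (x ^ d j)⁻¹)) • L (v j)) (𝓝[≠] 0)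
        (𝓝 (if j = i then L (v i) else 0)) := by
    intro j hj
    have h1 : Tendsto (fun x => 1 + h j x) (𝓝[≠] 0) (𝓝 1) := by
      simpa using (tendsto_const_nhds (x := (1 : ℂ))).add (hh0 j hj)
    rcases lt_trichotomy j i with hlt | rfl | hgt
    · simp [hL j hj hlt, hlt.ne]
    · have h2 := h1.smul_const (L (v j))
      simp only [one_smul] at h2
      simp only [if_true]
      refine h2.congr' ?_
      filter_upwards [self_mem_nhdsWithin] with x hx
      rw [mul_inv_cancel₀ (pow_ne_zero _ hx), mul_one]
    · have hd : d j < d i := he.strictAnti (a := i) (b := j)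
        ⟨(Finset.mem_Icc.1 hi).1, (Finset.mem_Icc.1 hi).2.trans (Nat.le_succ _)⟩
        ⟨(Finset.mem_Icc.1 hj).1, (Finset.mem_Icc.1 hj).2.trans (Nat.le_succ _)⟩ hgt
      have h3 : Tendsto (fun x : ℂ => x ^ d i * (x ^ d j)⁻¹) (𝓝[≠] 0) (𝓝 0) := by
        have h4 := hid.pow (d i - d j)
        rw [zero_pow (by omega)] at h4
        refine h4.congr' ?_
        filter_upwards [self_mem_nhdsWithin] with x hx
        exact pow_sub₀ x hx hd.le
      have h5 := (h1.mul h3).smul_const (L (v j))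
      simpa [hgt.ne'] using h5
  have hsum := tendsto_finsetSum (Finset.Icc 1 k) hterm
  rw [Finset.sum_ite_eq' (Finset.Icc 1 k) i, if_pos hi] at hsum
  have hrem : Tendsto (fun x => x ^ d i • L (r x)) (𝓝[≠] 0) (𝓝 0) := by
    have h1 := (hid.pow (d i)).smul ((L.continuous.tendsto 0).comp hr0)
    simpa using h1
  have htot := hsum.add hrem
  rw [add_zero] at htot
  refine htot.congr' ?_
  filter_upwards [hf] with x hx
  rw [hx]
  simp only [map_add, map_sub, map_sum, map_smul]
  rw [add_right_comm, add_sub_cancel_right, smul_add, Finset.smul_sum]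
  congr 1
  refine Finset.sum_congr rfl fun j _ => ?_
  rw [smul_smul]
  congr 1
  ring

theorem IsExpansion.exists_remainder {f : ℂ → E} {k : ℕ} {d : ℕ → ℕ} {v : ℕ → E}
    (he : IsExpansion f k d v) :
    ∃ r : ℂ → E, Tendsto r (𝓝[≠] 0) (𝓝 0) ∧
      ∀ᶠ x in 𝓝[≠] (0 : ℂ), f x - v (k + 1) - r x ∈ flag v k := by
  obtain ⟨h, r, hh, hr, hf⟩ := he.expansion
  refine ⟨r, hr.trans_tendsto nhdsWithin_le_nhds, ?_⟩
  filter_upwards [hf] with x hx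
  rw [hx, sub_sub, add_assoc, add_sub_cancel_right]
  refine Submodule.sum_mem _ fun j hj => Submodule.smul_mem _ _ (Submodule.subset_span ?_)
  exact ⟨j, by simpa using hj, rfl⟩

theorem IsExpansion.zero_lt {f : ℂ → E} {k : ℕ} {d : ℕ → ℕ} {v : ℕ → E}
    (he : IsExpansion f k d v) {j : ℕ} (hj : j ∈ Finset.Icc 1 k) : 0 < d j := by
  have hj := Finset.mem_Icc.1 hj
  have := he.strictAnti (a := j) (b := k + 1) ⟨hj.1, by omega⟩ ⟨by omega, le_rfl⟩ (by omega)
  rwa [he.last] at this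

/-- Iterated difference quotients at `0`, which stay holomorphic by removability of the singularity.
-/
theorem exists_taylor {F : ℂ → E} (hF : DifferentiableOn ℂ F (Metric.ball 0 1)) (M : ℕ)
    [CompleteSpace E] :
    ∃ (a : ℕ → E) (G : ℂ → E), DifferentiableOn ℂ G (Metric.ball 0 1) ∧
      ∀ x, F x = ∑ n ∈ Finset.range M, x ^ n • a n + x ^ M • G x := by
  induction M with
  | zero => exact ⟨0, F, hF, by simp⟩
  | succ M ih =>
    obtain ⟨a, G, hG, h⟩ := ih
    refine ⟨fun n => if n = M then G 0 else a n, dslope G 0,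
      (Complex.differentiableOn_dslope (Metric.ball_mem_nhds _ one_pos)).2 hG, fun x => ?_⟩
    rw [h x, Finset.sum_range_succ]
    simp only [if_true]
    have h1 : ∑ n ∈ Finset.range M, x ^ n • (if n = M then G 0 else a n) =
        ∑ n ∈ Finset.range M, x ^ n • a n := Finset.sum_congr rfl fun n hn => by
      rw [if_neg (Finset.mem_range.1 hn).ne]
    have h2 : G x = G 0 + x • dslope G 0 x := by
      have := sub_smul_dslope G 0 x
      rw [sub_zero] at this
      rw [this]; abel
    rw [h1, add_assoc, pow_succ, ← smul_smul, ← smul_add, ← h2]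

/-- A greedy choice of an independent subfamily, starting from the top index. -/
theorem exists_greedy_basis (c : ℕ → E) (D : ℕ) :
    ∃ (S : Finset ℕ) (α : ℕ → ℕ → ℂ), S ⊆ Finset.Icc 1 D ∧ LinearIndepOn ℂ c (S : Set ℕ) ∧
      (∀ m ∈ Finset.Icc 1 D, c m = ∑ s ∈ S, α m s • c s) ∧
      (∀ m ∈ Finset.Icc 1 D, ∀ s ∈ S, s < m → α m s = 0) ∧ ∀ s ∈ S, α s s = 1 := by
  -- Downward induction on the index: `c m` is kept unless it lies in the span of the kept vectors
  -- of larger index. This triangularity is what later turns dropped coefficients into factors `1 +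
  -- O(x)`.
  have key : ∀ j ≤ D, ∃ (S : Finset ℕ) (α : ℕ → ℕ → ℂ), S ⊆ Finset.Ioc (D - j) D ∧
      LinearIndepOn ℂ c (S : Set ℕ) ∧
      (∀ m ∈ Finset.Ioc (D - j) D, c m = ∑ s ∈ S, α m s • c s) ∧
      (∀ m ∈ Finset.Ioc (D - j) D, ∀ s ∈ S, s < m → α m s = 0) ∧ ∀ s ∈ S, α s s = 1 := by
    intro j
    induction j with
    | zero => intro _; exact ⟨∅, 0, by simp⟩
    | succ j ih =>
      intro hj
      obtain ⟨S, α, hS, hli, h1, h2, h3⟩ := ih (by omega)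
      set m := D - j with hm
      have hIoc : ∀ n, n ∈ Finset.Ioc (D - (j + 1)) D ↔ n = m ∨ n ∈ Finset.Ioc m D := by
        intro n; simp only [Finset.mem_Ioc]; omega
      have hmS : ∀ s ∈ S, m < s := fun s hs => (Finset.mem_Ioc.1 (hS hs)).1
      have hmS' : m ∉ S := fun h => (hmS m h).false
      by_cases hc : c m ∈ Submodule.span ℂ (c '' (S : Set ℕ))
      · obtain ⟨β, hβ⟩ : ∃ β : ℕ → ℂ, ∑ s ∈ S, β s • c s = c m := by
          obtain ⟨β, hβ⟩ := (Submodule.mem_span_image_finset_iff_exists_fun ℂ).1 hc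
          refine ⟨fun s => if h : s ∈ S then β ⟨s, h⟩ else 0, ?_⟩
          rw [← hβ, ← Finset.sum_coe_sort]
          exact Finset.sum_congr rfl fun s _ => by simp
        refine ⟨S, fun n s => if n = m then β s else α n s, ?_, hli, ?_, ?_, ?_⟩
        · intro s hs; exact (hIoc s).2 (Or.inr (hS hs))
        · intro n hn
          rcases (hIoc n).1 hn with rfl | hn
          · simp [hβ]
          · have : n ≠ m := (Finset.mem_Ioc.1 hn).1.ne'
            simpa [this] using h1 n hn
        · intro n hn s hs hsn
          rcases (hIoc n).1 hn with rfl | hn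
          · exact absurd hsn (hmS s hs).not_gt
          · have : n ≠ m := (Finset.mem_Ioc.1 hn).1.ne'
            simpa [this] using h2 n hn s hs hsn
        · intro s hs
          simpa [(hmS s hs).ne'] using h3 s hs
      · refine ⟨insert m S, fun n s => if n = m then (if s = m then 1 else 0) else
          if s = m then 0 else α n s, ?_, ?_, ?_, ?_, ?_⟩
        · intro s hs
          rcases Finset.mem_insert.1 hs with rfl | hs
          · exact (hIoc _).2 (Or.inl rfl)
          · exact (hIoc s).2 (Or.inr (hS hs))
        · rw [Finset.coe_insert]
          exact hli.insert hc
        · intro n hn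
          rw [Finset.sum_insert hmS']
          rcases (hIoc n).1 hn with rfl | hn
          · rw [Finset.sum_eq_zero]
            · simp
            · intro s hs; simp [(hmS s hs).ne']
          · have : n ≠ m := (Finset.mem_Ioc.1 hn).1.ne'
            simp only [this, if_false, if_true, zero_smul, zero_add]
            rw [h1 n hn]
            exact Finset.sum_congr rfl fun s hs => by simp [(hmS s hs).ne']
        · intro n hn s hs hsn
          rcases (hIoc n).1 hn with rfl | hn
          · simp [hsn.ne]
          · have : n ≠ m := (Finset.mem_Ioc.1 hn).1.ne'
            rcases Finset.mem_insert.1 hs with rfl | hs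
            · simp [this]
            · simpa [this, (hmS s hs).ne'] using h2 n hn s hs hsn
        · intro s hs
          rcases Finset.mem_insert.1 hs with rfl | hs
          · simp
          · simpa [(hmS s hs).ne'] using h3 s hs
  have := key D le_rfl
  rwa [Nat.sub_self] at this

theorem exists_decreasing_enumeration (S : Finset ℕ) (hS : ∀ s ∈ S, 0 < s) :
    ∃ d : ℕ → ℕ, StrictAntiOn d (Set.Icc 1 (S.card + 1)) ∧ d (S.card + 1) = 0 ∧
      (Finset.Icc 1 S.card).image d = S := by
  induction S using Finset.induction_on_max with
  | empty => exact ⟨0, by simp, by simp, by simp⟩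
  | insert a S ha ih =>
    have haS : a ∉ S := fun h => (ha a h).false
    obtain ⟨d, hd, hd0, hdS⟩ := ih fun s hs => hS s (Finset.mem_insert_of_mem hs)
    have hpos := hS a (Finset.mem_insert_self _ _)
    rw [Finset.card_insert_of_notMem haS]
    have hda : ∀ j ∈ Set.Icc 1 (S.card + 1), d j < a := by
      intro j hj
      rcases eq_or_lt_of_le hj.2 with h | h
      · rw [h, hd0]; exact hpos
      · refine ha _ ?_
        rw [← hdS]
        exact Finset.mem_image_of_mem _ (Finset.mem_Icc.2 ⟨hj.1, by omega⟩)
    -- The new maximum takes index `1` and the earlier values shift by one; the value at `0` is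
    -- irrelevant.
    refine ⟨fun j => if j ≤ 1 then a else d (j - 1), ?_, ?_, ?_⟩
    · intro i hi j hj hij
      have h1 := hi.1
      have h2 := hj.2
      have hj1 : ¬ j ≤ 1 := by omega
      simp only [hj1, if_false]
      split_ifs with h
      · exact hda _ ⟨by omega, by omega⟩
      · exact hd ⟨by omega, by omega⟩ ⟨by omega, by omega⟩ (by omega)
    · simpa using hd0
    · ext s
      simp only [Finset.mem_image, Finset.mem_Icc, Finset.mem_insert]
      have hmem : s ∈ S ↔ ∃ j, (1 ≤ j ∧ j ≤ S.card) ∧ d j = s := by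
        conv_lhs => rw [← hdS]
        simp
      rw [hmem]
      constructor
      · rintro ⟨j, ⟨h1, h2⟩, h3⟩
        split_ifs at h3 with h
        · exact Or.inl h3.symm
        · exact Or.inr ⟨j - 1, ⟨by omega, by omega⟩, h3⟩
      · rintro (rfl | ⟨j, ⟨h1, h2⟩, h3⟩)
        · exact ⟨1, ⟨le_rfl, by omega⟩, by simp⟩
        · refine ⟨j + 1, ⟨by omega, by omega⟩, ?_⟩
          rw [if_neg (by omega)]
          simpa using h3

theorem exists_laurent [CompleteSpace E] {f : ℂ → E} (hf : DifferentiableOn ℂ f puncturedDisc)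
    (hgrowth : HasPolynomialGrowth f) :
    ∃ (D : ℕ) (c : ℕ → E) (r : ℂ → E), r =O[𝓝[≠] (0 : ℂ)] (fun x => x) ∧
      ∀ x ∈ puncturedDisc, f x = ∑ m ∈ Finset.Icc 1 D, (x ^ m)⁻¹ • c m + c 0 + r x := by
  obtain ⟨N, hN⟩ := hgrowth
  have hid : Tendsto (fun x : ℂ => x) (𝓝[≠] 0) (𝓝 0) := nhdsWithin_le_nhds
  -- One more than the growth exponent, so that `x^D f` has a limit, namely `0`, and not merely a
  -- bound.
  set D := N.toNat + 1 with hD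
  have hlim : Tendsto (fun x => x ^ D • f x) (𝓝[≠] 0) (𝓝 0) := by
    have h1 : (fun x => x ^ D • f x) =O[𝓝[≠] (0 : ℂ)] fun x => x ^ D • x ^ (-N) :=
      (isBigO_refl _ _).smul hN
    refine h1.trans_tendsto ?_
    have h2 := hid.pow (D - N : ℤ).toNat
    rw [zero_pow (by omega)] at h2
    refine h2.congr' ?_
    filter_upwards [self_mem_nhdsWithin] with x hx
    rw [smul_eq_mul, ← zpow_natCast, ← zpow_natCast, ← zpow_add₀ hx]
    congr 1
    omega
  obtain ⟨F, hF, -, hfF, -⟩ := exists_holomorphic_factor hf hlim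
  -- Order `D + 1` keeps the constant term of `f` and leaves a remainder `x • G x` after division by
  -- `x^D`.
  obtain ⟨a, G, hG, hFG⟩ := exists_taylor hF (D + 1)
  refine ⟨D, fun m => a (D - m), fun x => x • G x, ?_, fun x hx => ?_⟩
  · have h1 : G =O[𝓝[≠] (0 : ℂ)] fun _ => (1 : ℂ) :=
      ((hG.continuousOn.continuousAt (Metric.ball_mem_nhds _ one_pos)).tendsto.mono_left
        nhdsWithin_le_nhds).isBigO_one ℂ
    simpa using (isBigO_refl (fun x : ℂ => x) _).smul h1
  · have hx0 := hx.1
    rw [hfF x hx, hFG x, smul_add, smul_smul, ← Finset.sum_range_reflect, Finset.smul_sum]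
    congr 1
    · rw [Finset.sum_range_succ', Finset.range_eq_Ico, Finset.sum_Ico_add' (c := 1)
        (f := fun m => (x ^ D)⁻¹ • x ^ (D + 1 - 1 - m) • a (D + 1 - 1 - m))]
      congr 1
      · refine Finset.sum_congr (by ext; simp) fun m hm => ?_
        have : m ≤ D := by simp at hm; omega
        rw [smul_smul, Nat.add_sub_cancel]
        congr 1
        rw [pow_sub₀ x hx0 this, inv_mul_cancel_left₀ (pow_ne_zero _ hx0)]
      · rw [smul_smul, Nat.add_sub_cancel, Nat.sub_zero, inv_mul_cancel₀ (pow_ne_zero _ hx0),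
          one_smul]
        simp
    · congr 1
      rw [pow_succ x D, inv_mul_cancel_left₀ (pow_ne_zero _ hx0)]

/-- The `v_j` are the kept Laurent coefficients `c (d j)`. A dropped `c m` involves only kept `c s`
with `s > m`, and `x^{-m} = x^{s-m} x^{-s}` is absorbed in the `O(x)` correction of the term in `c
s`. -/
theorem exists_isExpansion [CompleteSpace E] {f : ℂ → E}
    (hcont : ContinuousOn f closedPuncturedDisc) (hf : DifferentiableOn ℂ f puncturedDisc)
    (hgrowth : HasPolynomialGrowth f)
    (hunb : ¬ Bornology.IsBounded (f '' closedPuncturedDisc)) :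
    ∃ (k : ℕ) (d : ℕ → ℕ) (v : ℕ → E), IsExpansion f k d v := by
  obtain ⟨D, c, r, hr, hfr⟩ := exists_laurent hf hgrowth
  obtain ⟨S, α, hSD, hli, h1, h2, h3⟩ := exists_greedy_basis c D
  obtain ⟨d, hd, hd0, hdS⟩ := exists_decreasing_enumeration S
    fun s hs => (Finset.mem_Icc.1 (hSD hs)).1
  have hinj : Set.InjOn d (Finset.Icc 1 S.card) := hd.injOn.mono fun j hj => by
    simp only [Finset.coe_Icc, Set.mem_Icc] at hj ⊢; omega
  have hdS' : d '' Set.Icc 1 S.card = S := by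
    conv_rhs => rw [← hdS]
    simp
  refine ⟨S.card, d, fun j => c (d j), ?_, hd, hd0, ?_, ?_⟩
  -- If nothing is kept, the polar part vanishes; then `f` is bounded near `0`, and on the remaining
  -- closed annulus by compactness.
  · rw [Nat.one_le_iff_ne_zero, Ne, Finset.card_eq_zero]
    rintro rfl
    apply hunb
    have hc : ∀ m ∈ Finset.Icc 1 D, c m = 0 := fun m hm => by simpa using h1 m hm
    have hlim : Tendsto f (𝓝[≠] 0) (𝓝 (c 0)) := by
      have h4 : Tendsto (fun x => c 0 + r x) (𝓝[≠] 0) (𝓝 (c 0 + 0)) :=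
        tendsto_const_nhds.add (hr.trans_tendsto nhdsWithin_le_nhds)
      rw [add_zero] at h4
      refine h4.congr' ?_
      filter_upwards [puncturedDisc_mem_nhdsNE] with x hx
      rw [hfr x hx, Finset.sum_eq_zero fun m hm => by rw [hc m hm, smul_zero], zero_add]
    obtain ⟨ε, hε, hb⟩ := Metric.mem_nhdsWithin_iff.1 (hlim (Metric.ball_mem_nhds (c 0) one_pos))
    have hK : IsCompact {x : ℂ | ε ≤ ‖x‖ ∧ ‖x‖ ≤ 1} :=
      Metric.isCompact_of_isClosed_isBounded
        ((isClosed_le continuous_const continuous_norm).inter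
          (isClosed_le continuous_norm continuous_const))
        ((Metric.isBounded_closedBall (x := (0 : ℂ)) (r := 1)).subset
          fun x hx => by simpa using hx.2)
    have hfK := (hK.image_of_continuousOn (hcont.mono fun x hx =>
      ⟨norm_pos_iff.1 (hε.trans_le hx.1), hx.2⟩)).isBounded
    refine (hfK.union (Metric.isBounded_ball (x := c 0) (r := 1))).subset ?_
    rintro _ ⟨x, hx, rfl⟩
    by_cases hxε : ε ≤ ‖x‖
    · exact Or.inl ⟨x, ⟨hxε, hx.2⟩, rfl⟩
    · exact Or.inr (hb ⟨by simpa using hxε, hx.1⟩)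
  · have : LinearIndepOn ℂ c (d '' Set.Icc 1 S.card) := by rwa [hdS']
    exact this.comp_of_image (by simpa using hinj)
  · refine ⟨fun j x => ∑ m ∈ (Finset.Icc 1 D).filter (· < d j), α m (d j) * x ^ (d j - m), r,
      ?_, hr, ?_⟩
    · intro j hj
      refine IsBigO.fun_sum fun m hm => ?_
      have hm := (Finset.mem_filter.1 hm).2
      refine IsBigO.const_mul_left ?_ _
      obtain ⟨n, hn⟩ : ∃ n, d j - m = n + 1 := ⟨d j - m - 1, by omega⟩
      simp only [hn, pow_succ]
      have h4 : (fun x : ℂ => x ^ n) =O[𝓝[≠] (0 : ℂ)] fun _ => (1 : ℂ) := by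
        have : Tendsto (fun x : ℂ => x ^ n) (𝓝[≠] 0) (𝓝 (0 ^ n)) :=
          ((continuous_pow n).tendsto 0).mono_left nhdsWithin_le_nhds
        exact this.isBigO_one ℂ
      simpa using h4.mul (isBigO_refl (fun x : ℂ => x) _)
    · filter_upwards [puncturedDisc_mem_nhdsNE] with x hx
      have hx0 := hx.1
      rw [hfr x hx]
      simp only [hd0]
      congr 2
      rw [← Finset.sum_image (s := Finset.Icc 1 S.card) (g := d) (f := fun s =>
        ((1 + ∑ m ∈ (Finset.Icc 1 D).filter (· < s), α m s * x ^ (s - m)) * (x ^ s)⁻¹) • c s)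
        hinj, hdS]
      have e1 : ∑ m ∈ Finset.Icc 1 D, (x ^ m)⁻¹ • c m =
          ∑ s ∈ S, (∑ m ∈ Finset.Icc 1 D, (x ^ m)⁻¹ * α m s) • c s := by
        simp only [Finset.sum_smul]
        rw [Finset.sum_comm]
        refine Finset.sum_congr rfl fun m hm => ?_
        conv_lhs => rw [h1 m hm, Finset.smul_sum]
        exact Finset.sum_congr rfl fun s _ => by rw [smul_smul]
      rw [e1]
      refine Finset.sum_congr rfl fun s hs => ?_
      congr 1
      have hsD := hSD hs
      rw [← Finset.sum_filter_add_sum_filter_not _ (fun m => m < s)]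
      -- Only `m = s` survives: it gives the `1` of `1 + h`, while `α m s = 0` for `m > s`.
      have e2 : ∑ m ∈ (Finset.Icc 1 D).filter (fun m => ¬ m < s), (x ^ m)⁻¹ * α m s =
          (x ^ s)⁻¹ := by
        rw [Finset.sum_eq_single_of_mem s (by simp [Finset.mem_Icc.1 hsD])]
        · rw [h3 s hs, mul_one]
        · intro m hm hms
          have hm := Finset.mem_filter.1 hm
          rw [h2 m hm.1 s hs (by omega), mul_zero]
      rw [e2, add_mul, one_mul, add_comm, Finset.sum_mul]
      congr 1
      refine Finset.sum_congr rfl fun m hm => ?_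
      have hm := (Finset.mem_filter.1 hm).2
      rw [pow_sub₀ x hx0 hm.le]
      field_simp

end OneDimFlow

/-! ### Haar measures on translates, and Weyl's criterion on tori -/

namespace OneDimFlow

section HaarOnTranslate

variable {K T : Type*} [AddCommGroup K] [TopologicalSpace K] [IsTopologicalAddGroup K]
  [CompactSpace K] [MeasurableSpace K] [BorelSpace K]
  [AddCommGroup T] [TopologicalSpace T] [IsTopologicalAddGroup T]
  [MeasurableSpace T] [BorelSpace T]

/-- The normalized Haar measure of a compact group. -/
noncomputable def haarProb (K : Type*) [AddCommGroup K] [TopologicalSpace K]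
    [IsTopologicalAddGroup K] [CompactSpace K] [MeasurableSpace K] [BorelSpace K] : Measure K :=
  Measure.addHaarMeasure (⊤ : TopologicalSpace.PositiveCompacts K)

instance : (haarProb K).IsAddHaarMeasure := by unfold haarProb; infer_instance

instance : IsProbabilityMeasure (haarProb K) := ⟨by
  simpa [haarProb] using Measure.addHaarMeasure_self
    (K₀ := (⊤ : TopologicalSpace.PositiveCompacts K))⟩

theorem isHaarProbabilityOn_map [T2Space T] (φ : K →+ T) (hφ : Continuous φ) (p : T) :
    IsHaarProbabilityOn ((haarProb K).map fun θ => p + φ θ) (Set.range fun θ => p + φ θ) := by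
  have hc : Continuous fun θ => p + φ θ := by fun_prop
  have hS : IsClosed (Set.range fun θ => p + φ θ) := (isCompact_range hc).isClosed
  refine ⟨Measure.isProbabilityMeasure_map hc.aemeasurable, ?_, fun t ht => ?_⟩
  · rw [Measure.map_apply hc.measurable hS.measurableSet.compl]
    have : (fun θ => p + φ θ) ⁻¹' (Set.range fun θ => p + φ θ)ᶜ = ∅ := by
      ext; simp
    rw [this, measure_empty]
  -- Looking at the image of the point `p` shows that a translation preserving the set is by an
  -- element of `φ(K)`.
  · obtain ⟨θ, hθ⟩ : t + p ∈ Set.range fun θ => p + φ θ := by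
      rw [← ht]
      exact ⟨p, ⟨0, by simp⟩, rfl⟩
    have htθ : t = φ θ := by
      have : p + φ θ = t + p := hθ
      rw [add_comm t p] at this
      exact (add_left_cancel this).symm
    rw [Measure.map_map (by fun_prop) hc.measurable]
    have : (fun s => t + s) ∘ (fun θ => p + φ θ) = (fun θ => p + φ θ) ∘ fun η => θ + η := by
      funext η
      simp only [Function.comp, map_add, htθ]
      abel
    rw [this, ← Measure.map_map hc.measurable (by fun_prop), map_add_left_eq_self]

/-- The measure of `{(θ, t) | φ θ + t ∈ A}` is computed by Fubini in both orders: invariance of `ν`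
gives `ν A`, invariance of the Haar measure of `K` gives the image measure of `A`. -/
theorem isHaarProbabilityOn_unique [SecondCountableTopology K] [SecondCountableTopology T]
    (φ : K →+ T) (hφ : Continuous φ)
    (p : T) {ν : Measure T}
    (hν : IsHaarProbabilityOn ν (Set.range fun θ => p + φ θ)) :
    ν = (haarProb K).map fun θ => p + φ θ := by
  have := hν.prob
  have hc : Continuous fun θ => p + φ θ := by fun_prop
  ext A hA
  have hB : MeasurableSet ((fun q : K × T => φ q.1 + q.2) ⁻¹' A) := by
    have hm : Measurable fun q : K × T => φ q.1 + q.2 :=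
      ((hφ.measurable.comp measurable_fst).add measurable_snd)
    exact hm hA
  have h1 : ((haarProb K).prod ν) ((fun q : K × T => φ q.1 + q.2) ⁻¹' A) = ν A := by
    rw [Measure.prod_apply hB]
    have : ∀ θ : K, ν (Prod.mk θ ⁻¹' ((fun q : K × T => φ q.1 + q.2) ⁻¹' A)) = ν A := by
      intro θ
      have hinv := hν.invariant (φ θ) (by
        ext s
        constructor
        · rintro ⟨_, ⟨η, rfl⟩, rfl⟩
          exact ⟨θ + η, by simp only [map_add]; abel⟩
        · rintro ⟨η, rfl⟩
          exact ⟨p + φ (η - θ), ⟨η - θ, rfl⟩, by simp only [map_sub]; abel⟩)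
      conv_rhs => rw [← hinv, Measure.map_apply (by fun_prop) hA]
      rfl
    simp [this]
  have h2 : ((haarProb K).prod ν) ((fun q : K × T => φ q.1 + q.2) ⁻¹' A) =
      ((haarProb K).map fun θ => p + φ θ) A := by
    rw [Measure.prod_apply_symm hB]
    have : ∀ᵐ t ∂ν, (haarProb K) ((fun θ => (θ, t)) ⁻¹' ((fun q : K × T => φ q.1 + q.2) ⁻¹' A)) =
        ((haarProb K).map fun θ => p + φ θ) A := by
      have hae : ∀ᵐ t ∂ν, t ∈ Set.range fun θ => p + φ θ := hν.carried
      filter_upwards [hae]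
      rintro _ ⟨η, rfl⟩
      conv_rhs => rw [Measure.map_apply hc.measurable hA, ← map_add_right_eq_self (haarProb K) η,
        Measure.map_apply (by fun_prop) (hc.measurable hA)]
      congr 1
      ext θ
      simp only [Set.mem_preimage, map_add]
      rw [add_left_comm]
    rw [lintegral_congr_ae this]
    simp
  rw [← h1, h2]

end HaarOnTranslate

section Torus

variable {ι : Type*} [Fintype ι]

theorem mFourier_add_apply (n : ι → ℤ) (s t : UnitAddTorus ι) :
    UnitAddTorus.mFourier n (s + t) = UnitAddTorus.mFourier n s * UnitAddTorus.mFourier n t := by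
  simp [UnitAddTorus.mFourier, Finset.prod_mul_distrib, smul_add, AddCircle.toCircle_add]

theorem mFourier_coe (n : ι → ℤ) (t : ι → ℝ) :
    UnitAddTorus.mFourier n (fun i => (t i : UnitAddCircle)) =
      Complex.exp (2 * Real.pi * Complex.I * ((∑ i, n i * t i : ℝ) : ℂ)) := by
  simp only [UnitAddTorus.mFourier, ContinuousMap.coe_mk]
  simp only [fourier_coe_apply]
  rw [← Complex.exp_sum]
  congr 1
  push_cast
  rw [Finset.mul_sum]
  refine Finset.sum_congr rfl fun i _ => ?_
  ring

theorem integral_mFourier_eq_zero {n : ι → ℤ} (hn : n ≠ 0) :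
    ∫ t, UnitAddTorus.mFourier n t ∂(haarProb (UnitAddTorus ι)) = 0 := by
  classical
  obtain ⟨i, hi⟩ := Function.ne_iff.1 hn
  -- Translation by this half period multiplies the character by `exp (πi) = -1`.
  let h : ι → ℝ := Pi.single i (1 / (2 * n i) : ℝ)
  refine integral_eq_zero_of_add_right_eq_neg (g := fun i => (h i : UnitAddCircle)) fun t => ?_
  rw [mFourier_add_apply, mFourier_coe]
  have : ∑ j, (n j : ℝ) * h j = 1 / 2 := by
    rw [Finset.sum_eq_single i]
    · have : (n i : ℝ) ≠ 0 := by exact_mod_cast hi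
      simp only [h, Pi.single_eq_same]; field_simp
    · intro j _ hj; simp [h, hj]
    · simp
  rw [this]
  have : (2 * Real.pi * Complex.I * ((1 / 2 : ℝ) : ℂ)) = Real.pi * Complex.I := by
    push_cast; ring
  rw [this, Complex.exp_pi_mul_I]
  ring

/-- Every non-trivial integral combination of the coordinates of `θ` is the real part of a
holomorphic function with a pole at `0`. -/
def HasPolarCharacters (θ : ℂ → ι → ℝ) : Prop :=
  ∀ n : ι → ℤ, n ≠ 0 → ∃ (Q : ℂ → ℂ) (D : ℕ) (b : ℂ),
    DifferentiableOn ℂ Q puncturedDisc ∧ D ≠ 0 ∧ b ≠ 0 ∧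
    Tendsto (fun x => x ^ D * Q x) (𝓝[≠] 0) (𝓝 b) ∧ ∀ x, (Q x).re = ∑ i, n i * θ x i

/-- Equidistribution on a torus, from the behaviour of the non-trivial characters. -/
theorem tendsto_setIntegral_torus {θ : ℂ → ι → ℝ} (hθ : ContinuousOn θ puncturedDisc)
    (hchar : HasPolarCharacters θ)
    {U : Set ℂ} (hU : IsOpen U) (hUD : closure U ⊆ puncturedDisc) {ρ : ℂ → ℂ}
    (hρ : ContDiffOn ℝ 1 ρ {0}ᶜ) (G : C(UnitAddTorus ι, ℂ)) :
    Tendsto (fun a : ℂ => ∫ y in U, G (fun i => (θ (a * y) i : UnitAddCircle)) * ρ y) (𝓝[≠] 0)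
      (𝓝 ((∫ t, G t ∂(haarProb (UnitAddTorus ι))) * ∫ y in U, ρ y)) := by
  have hK := isCompact_closure_of_subset hUD
  have hρc : ContinuousOn ρ (closure U) := hρ.continuousOn.mono fun x hx => (hUD hx).1
  have hρi : IntegrableOn ρ U := (hρc.integrableOn_compact hK).mono_set subset_closure
  have hGi : ∀ G : C(UnitAddTorus ι, ℂ), Integrable G (haarProb (UnitAddTorus ι)) := fun G =>
    G.continuous.integrable_of_hasCompactSupport (HasCompactSupport.of_compactSpace _)
  let J : C(UnitAddTorus ι, ℂ) → ℂ → ℂ := fun G a =>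
    ∫ y in U, G (fun i => (θ (a * y) i : UnitAddCircle)) * ρ y
  let J0 : C(UnitAddTorus ι, ℂ) → ℂ := fun G =>
    (∫ t, G t ∂(haarProb (UnitAddTorus ι))) * ∫ y in U, ρ y
  have hint : ∀ (G : C(UnitAddTorus ι, ℂ)), ∀ a ∈ puncturedDisc,
      IntegrableOn (fun y => G (fun i => (θ (a * y) i : UnitAddCircle)) * ρ y) U := by
    intro G a ha
    refine hρi.bdd_mul (c := ‖G‖) ?_ (Eventually.of_forall fun y => G.norm_coe_le_norm _)
    refine ContinuousOn.aestronglyMeasurable ?_ hU.measurableSet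
    have h1 : ContinuousOn (fun y => θ (a * y)) U := hθ.comp (by fun_prop)
      fun y hy => mul_mem_puncturedDisc ha (hUD (subset_closure hy))
    have h2 : Continuous fun t : ι → ℝ => fun i => (t i : UnitAddCircle) :=
      continuous_pi fun i => (AddCircle.continuous_mk' 1).comp (continuous_apply i)
    exact (G.continuous.comp h2).comp_continuousOn h1
  -- Averages and limit are Lipschitz in `G` for the sup norm, with a constant independent of `a`;
  -- it therefore suffices to treat the dense span of the characters.
  have hdiff : ∀ (G G' : C(UnitAddTorus ι, ℂ)), ∀ a ∈ puncturedDisc,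
      ‖J G a - J G' a‖ ≤ ‖G - G'‖ * ∫ y in U, ‖ρ y‖ := by
    intro G G' a ha
    simp only [J]
    rw [← integral_sub (hint G a ha) (hint G' a ha), ← integral_const_mul]
    refine norm_integral_le_of_norm_le (hρi.norm.const_mul _) (Eventually.of_forall fun y => ?_)
    rw [← sub_mul, norm_mul]
    exact mul_le_mul_of_nonneg_right ((G - G').norm_coe_le_norm _) (norm_nonneg _)
  have hdiff0 : ∀ (G G' : C(UnitAddTorus ι, ℂ)),
      ‖J0 G - J0 G'‖ ≤ ‖G - G'‖ * ∫ y in U, ‖ρ y‖ := by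
    intro G G'
    simp only [J0]
    rw [← sub_mul, norm_mul, ← integral_sub (hGi G) (hGi G')]
    refine mul_le_mul ?_ (norm_integral_le_integral_norm _) (norm_nonneg _) (norm_nonneg _)
    have := norm_integral_le_of_norm_le_const (μ := haarProb (UnitAddTorus ι))
      (Eventually.of_forall fun t => (G - G').norm_coe_le_norm t)
    simpa using this
  have hspan : ∀ G ∈ Submodule.span ℂ (Set.range (UnitAddTorus.mFourier (d := ι))),
      Tendsto (J G) (𝓝[≠] 0) (𝓝 (J0 G)) := by
    intro G hG
    induction hG using Submodule.span_induction with
    | mem G hG =>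
      obtain ⟨n, rfl⟩ := hG
      by_cases hn : n = 0
      · subst hn
        simp [J, J0, UnitAddTorus.mFourier_zero]
      · obtain ⟨Q, D, b, hQ, hD, hb, hlim, hQθ⟩ := hchar n hn
        simp only [J, J0, integral_mFourier_eq_zero hn, zero_mul]
        have := tendsto_setIntegral_phase_mul hQ hD hb hlim hU hUD hρ
        refine this.congr fun a => ?_
        simp only [phase, mFourier_coe, hQθ]
    | zero => simp [J, J0]
    | add G G' _ _ h h' =>
      have e0 : J0 (G + G') = J0 G + J0 G' := by
        simp only [J0, ContinuousMap.add_apply]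
        rw [integral_add (hGi G) (hGi G'), add_mul]
      rw [e0]
      refine (h.add h').congr' ?_
      filter_upwards [puncturedDisc_mem_nhdsNE] with a ha
      simp only [J, ContinuousMap.add_apply, add_mul]
      rw [integral_add (hint G a ha) (hint G' a ha)]
    | smul z G _ h =>
      have e0 : J0 (z • G) = z * J0 G := by
        simp only [J0, ContinuousMap.smul_apply, smul_eq_mul, integral_const_mul, mul_assoc]
      rw [e0]
      refine (h.const_mul z).congr fun a => ?_
      simp only [J, ContinuousMap.smul_apply, smul_eq_mul, mul_assoc, integral_const_mul]
  change Tendsto (J G) _ (𝓝 (J0 G))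
  set C : ℝ := ∫ y in U, ‖ρ y‖ with hC
  have hC0 : 0 ≤ C := integral_nonneg fun y => norm_nonneg _
  rw [Metric.tendsto_nhds]
  intro ε hε
  have hmem : G ∈ closure (Submodule.span ℂ (Set.range (UnitAddTorus.mFourier (d := ι))) :
      Set C(UnitAddTorus ι, ℂ)) := by
    have := UnitAddTorus.span_mFourier_closure_eq_top (d := ι)
    rw [← Submodule.topologicalClosure_coe, this]
    trivial
  have hη : 0 < ε / 3 / (C + 1) := by positivity
  obtain ⟨G', hG', hGG'⟩ := Metric.mem_closure_iff.1 hmem _ hη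
  rw [dist_eq_norm] at hGG'
  have hb : ‖G - G'‖ * C < ε / 3 := by
    rw [lt_div_iff₀ (by positivity)] at hGG'
    nlinarith [norm_nonneg (G - G')]
  filter_upwards [Metric.tendsto_nhds.1 (hspan G' hG') (ε / 3) (by positivity),
    puncturedDisc_mem_nhdsNE] with a ha haD
  have h1 := hdiff G G' a haD
  have h2 := hdiff0 G G'
  rw [← dist_eq_norm] at h1 h2
  have h3 := dist_triangle4 (J G a) (J G' a) (J0 G') (J0 G)
  rw [dist_comm (J0 G') (J0 G)] at h3
  linarith

end Torus

section TorusHom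

variable {E : Type*} [NormedAddCommGroup E] [InnerProductSpace ℂ E]

/-- The homomorphism `ℝ / ℤ → E / Γ` induced by `t ↦ t • e` for `e ∈ Γ`. -/
noncomputable def circleHom (Γ : AddSubgroup E) (e : E) (he : e ∈ Γ) : UnitAddCircle →+ E ⧸ Γ :=
  QuotientAddGroup.lift (AddSubgroup.zmultiples (1 : ℝ))
    ((QuotientAddGroup.mk' Γ).comp (LinearMap.toSpanSingleton ℝ E e).toAddMonoidHom) (by
      rw [AddSubgroup.zmultiples_le]
      simpa using he)

theorem continuous_circleHom (Γ : AddSubgroup E) (e : E) (he : e ∈ Γ) :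
    Continuous (circleHom Γ e he) := by
  refine Continuous.quotient_lift (f := fun t : ℝ => proj Γ (t • e)) ?_ _
  exact continuous_quot_mk.comp (by fun_prop)

/-- The homomorphism `(ℝ / ℤ)^ι → E / Γ` attached to a family of elements of `Γ`. -/
noncomputable def torusHom {ι : Type*} [Fintype ι] (Γ : AddSubgroup E) (b : ι → E)
    (hb : ∀ i, b i ∈ Γ) :
    UnitAddTorus ι →+ E ⧸ Γ where
  toFun θ := ∑ i, circleHom Γ (b i) (hb i) (θ i)
  map_zero' := by simp
  map_add' s t := by simp [Finset.sum_add_distrib]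

variable {ι : Type*} [Fintype ι] (Γ : AddSubgroup E) (b : ι → E)
    (hb : ∀ i, b i ∈ Γ)

theorem continuous_torusHom : Continuous (torusHom Γ b hb) := by
  refine continuous_finsetSum _ fun i _ => ?_
  exact (continuous_circleHom Γ (b i) (hb i)).comp (continuous_apply i)

theorem torusHom_coe (t : ι → ℝ) :
    torusHom Γ b hb (fun i => (t i : UnitAddCircle)) = proj Γ (∑ i, t i • b i) := by
  have : proj Γ (∑ i, t i • b i) = ∑ i, proj Γ (t i • b i) :=
    map_sum (QuotientAddGroup.mk' Γ) _ _
  rw [this]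
  rfl

theorem range_add_torusHom (c : E) {W : Submodule ℝ E}
    (hW : W = Submodule.span ℝ (Set.range b)) :
    (Set.range fun θ => proj Γ c + torusHom Γ b hb θ) =
      proj Γ '' (AffineSubspace.mk' c W : Set E) := by
  ext s
  constructor
  · rintro ⟨θ, rfl⟩
    choose t ht using fun i => QuotientAddGroup.mk_surjective (θ i)
    have : θ = fun i => (t i : UnitAddCircle) := funext fun i => (ht i).symm
    refine ⟨c + ∑ i, t i • b i, ?_, ?_⟩
    · rw [SetLike.mem_coe, AffineSubspace.mem_mk', vsub_eq_sub, add_sub_cancel_left, hW]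
      exact Submodule.sum_mem _ fun i _ =>
        Submodule.smul_mem _ _ (Submodule.subset_span ⟨i, rfl⟩)
    · rw [this]
      simp only [torusHom_coe]
      rfl
  · rintro ⟨x, hx, rfl⟩
    rw [SetLike.mem_coe, AffineSubspace.mem_mk', vsub_eq_sub, hW,
      Submodule.mem_span_range_iff_exists_fun] at hx
    obtain ⟨t, ht⟩ := hx
    refine ⟨fun i => (t i : UnitAddCircle), ?_⟩
    simp only [torusHom_coe, ht]
    change proj Γ (c + (x - c)) = proj Γ x
    rw [add_sub_cancel]

end TorusHom

end OneDimFlow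

/-! ### Rational hull of `𝔽_k`, torus parametrization and cluster values -/

namespace OneDimFlow

variable {E : Type*} [NormedAddCommGroup E] [InnerProductSpace ℂ E]

theorem exists_minimal_rational_hull [FiniteDimensional ℂ E] (Γ : AddSubgroup E)
    {F : Submodule ℝ E} (hF : F ≤ realSpan Γ) :
    ∃ W : Submodule ℝ E, F ≤ W ∧ W = Submodule.span ℝ ((Γ : Set E) ∩ W) ∧
      ∀ W' : Submodule ℝ E, F ≤ W' → W' = Submodule.span ℝ ((Γ : Set E) ∩ W') → W' ≤ W → W' = W := by
  let 𝒲 : Set (Submodule ℝ E) := {W | F ≤ W ∧ W = Submodule.span ℝ ((Γ : Set E) ∩ W)}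
  have hne : 𝒲.Nonempty := by
    refine ⟨realSpan Γ, hF, ?_⟩
    have : (Γ : Set E) ∩ (realSpan Γ : Set E) = Γ :=
      Set.inter_eq_left.2 Submodule.subset_span
    rw [this]
    rfl
  obtain ⟨W, hW, hmin⟩ := (wellFounded_lt (α := Submodule ℝ E)).has_min 𝒲 hne
  exact ⟨W, hW.1, hW.2, fun W' h1 h2 h3 => h3.eq_of_not_lt (hmin W' ⟨h1, h2⟩)⟩

/-- A real basis inside `Γ` of the smallest rational subspace containing `F`, with dual
functionals; by minimality no non-trivial integral combination of these vanishes on `F`. -/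
theorem exists_rational_frame [FiniteDimensional ℂ E] (Γ : AddSubgroup E)
    {F : Submodule ℝ E} (hF : F ≤ realSpan Γ) :
    ∃ (W : Submodule ℝ E) (m : ℕ) (b : Fin m → E) (l : Fin m → E →L[ℝ] ℝ), F ≤ W ∧
      W = Submodule.span ℝ ((Γ : Set E) ∩ W) ∧ (∀ i, b i ∈ Γ) ∧
      W = Submodule.span ℝ (Set.range b) ∧ (∀ w ∈ W, ∑ i, l i w • b i = w) ∧
      ∀ n : Fin m → ℤ, n ≠ 0 → ∃ u ∈ F, ∑ i, (n i : ℝ) * l i u ≠ 0 := by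
  obtain ⟨W, hFW, hW, hmin⟩ := exists_minimal_rational_hull Γ hF
  obtain ⟨b, hbΓ, hbspan, hbli⟩ :=
    Submodule.exists_fun_fin_finrank_span_eq ℝ ((Γ : Set E) ∩ W)
  replace hbspan := hbspan.trans hW.symm
  let B := Module.Basis.span hbli
  -- Any linear extension of the coordinates of `W` will do, since `f - v_{k+1}` is within `o(1)` of
  -- `W`.
  choose l hl using fun i => LinearMap.exists_extend (B.coord i)
  have hlw : ∀ w ∈ W, ∑ i, l i w • b i = w := by
    intro w hw
    rw [← hbspan] at hw
    have h1 := B.sum_repr ⟨w, hw⟩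
    have h2 := congrArg Subtype.val h1
    rw [AddSubmonoidClass.coe_finsetSum] at h2
    refine Eq.trans (Finset.sum_congr rfl fun i _ => ?_) h2
    have h3 : l i w = B.repr ⟨w, hw⟩ i := LinearMap.congr_fun (hl i) ⟨w, hw⟩
    rw [h3, Submodule.coe_smul, Module.Basis.span_apply]
  refine ⟨W, _, b, fun i => (l i).toContinuousLinearMap, hFW, hW, fun i => (hbΓ i).1,
    hbspan.symm, hlw, fun n hn => ?_⟩
  by_contra! hcon
  simp only [LinearMap.coe_toContinuousLinearMap'] at hcon
  have hlb : ∀ i j, l i (b j) = if i = j then 1 else 0 := by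
    intro i j
    have h := hlw (b j) (hbspan ▸ Submodule.subset_span ⟨j, rfl⟩)
    have h1 : ∑ i, (l i (b j) - if i = j then 1 else 0) • b i = 0 := by
      simp [sub_smul, Finset.sum_sub_distrib, h]
    exact sub_eq_zero.1 (Fintype.linearIndependent_iff.1 hbli _ h1 i)
  let ξ : E →ₗ[ℝ] ℝ := ∑ i, (n i : ℝ) • l i
  have hξ : ∀ u, ξ u = ∑ i, (n i : ℝ) * l i u := fun u => by simp [ξ]
  have hξb : ∀ j, ξ (b j) = n j := fun j => by simp [hξ, hlb]
  obtain ⟨j, hj⟩ := Function.ne_iff.1 hn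
  have hj' : (n j : ℝ) ≠ 0 := by exact_mod_cast hj
  -- As `ξ` has integral coefficients, `W ∩ ker ξ` is spanned by the vectors `n_j b_i - n_i b_j` of
  -- `Γ`. It also contains `F`, so minimality makes `ξ` vanish on `W`, against `ξ (b_j) = n_j ≠ 0`.
  have hker : W ⊓ LinearMap.ker ξ = W := by
    refine hmin _ (le_inf hFW fun u hu => ?_) (le_antisymm ?_ ?_) inf_le_left
    · rw [LinearMap.mem_ker, hξ]; exact hcon u hu
    · rintro w ⟨hwW, hwξ⟩
      have hwξ : ξ w = 0 := hwξ
      have h1 : (n j : ℝ) • w = ∑ i, l i w • ((n j) • b i - (n i) • b j) := by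
        have h2 : ∑ i, l i w • ((n j) • b i - (n i) • b j) =
            (n j : ℝ) • ∑ i, l i w • b i - (∑ i, (n i : ℝ) * l i w) • b j := by
          rw [Finset.smul_sum, Finset.sum_smul, ← Finset.sum_sub_distrib]
          refine Finset.sum_congr rfl fun i _ => ?_
          rw [← Int.cast_smul_eq_zsmul ℝ, ← Int.cast_smul_eq_zsmul ℝ, smul_sub, smul_smul,
            smul_smul, smul_smul, mul_comm (l i w), mul_comm (l i w)]
        rw [h2, hlw w hwW, ← hξ, hwξ, zero_smul, sub_zero]
      have h3 : w = (n j : ℝ)⁻¹ • ∑ i, l i w • ((n j) • b i - (n i) • b j) := by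
        rw [← h1, smul_smul, inv_mul_cancel₀ hj', one_smul]
      rw [h3]
      refine Submodule.smul_mem _ _ (Submodule.sum_mem _ fun i _ =>
        Submodule.smul_mem _ _ (Submodule.subset_span ⟨?_, ?_, ?_⟩))
      · exact Γ.sub_mem (Γ.zsmul_mem (hbΓ i).1 _) (Γ.zsmul_mem (hbΓ j).1 _)
      · exact W.sub_mem (W.toAddSubgroup.zsmul_mem (hbΓ i).2 _)
          (W.toAddSubgroup.zsmul_mem (hbΓ j).2 _)
      · rw [SetLike.mem_coe, LinearMap.mem_ker, map_sub, map_zsmul, map_zsmul, hξb, hξb]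
        simp only [zsmul_eq_mul]
        ring
    · exact Submodule.span_le.2 fun x hx => hx.2
  have h4 : b j ∈ W ⊓ LinearMap.ker ξ := by
    rw [hker]; exact (hbΓ j).2
  have h5 : ξ (b j) = 0 := h4.2
  exact hj' (by rw [← hξb, h5])

/-- `ξ` is the real part of a complex linear `η`, and `𝔽_k` is complex, so some `η (v_j)` is
non-zero. The first such `j` carries the dominant term. -/
theorem exists_character_pole [FiniteDimensional ℂ E] {f : ℂ → E}
    (hhol : DifferentiableOn ℂ f puncturedDisc) {k : ℕ} {d : ℕ → ℕ}
    {v : ℕ → E} (he : IsExpansion f k d v) (ξ : E →L[ℝ] ℝ) (hξ : ∃ u ∈ flag v k, ξ u ≠ 0) :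
    ∃ (Q : ℂ → ℂ) (D : ℕ) (b : ℂ), DifferentiableOn ℂ Q puncturedDisc ∧ D ≠ 0 ∧ b ≠ 0 ∧
      Tendsto (fun x => x ^ D * Q x) (𝓝[≠] 0) (𝓝 b) ∧ ∀ x, (Q x).re = ξ (f x - v (k + 1)) := by
  let η : E →L[ℂ] ℂ := StrongDual.extendRCLike (𝕜 := ℂ) ξ
  have hη : ∀ x, (η x).re = ξ x := fun x => StrongDual.re_extendRCLike_apply (𝕜 := ℂ) ξ x
  have hex : ∃ j, j ∈ Finset.Icc 1 k ∧ η (v j) ≠ 0 := by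
    by_contra! hcon
    obtain ⟨u, hu, hu0⟩ := hξ
    have : flag v k ≤ LinearMap.ker η.toLinearMap := by
      refine Submodule.span_le.2 ?_
      rintro _ ⟨j, hj, rfl⟩
      exact hcon j (by simpa using hj)
    have h1 : η u = 0 := this hu
    exact hu0 (by rw [← hη, h1, Complex.zero_re])
  classical
  have hj := Nat.find_spec hex
  refine ⟨fun x => η (f x - v (k + 1)), d (Nat.find hex), η (v (Nat.find hex)), ?_,
    (he.zero_lt hj.1).ne', hj.2, ?_, fun x => hη _⟩
  · exact η.differentiable.comp_differentiableOn (hhol.sub_const _)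
  · refine he.tendsto_pow_smul η hj.1 fun i hi hij => ?_
    by_contra h
    exact Nat.find_min hex hij ⟨hi, h⟩

/-- Up to an error tending to `0`, the composition `π ∘ f` factors through a curve on a torus
which satisfies the hypotheses of `tendsto_setIntegral_torus`. -/
theorem exists_torus_parametrization [FiniteDimensional ℂ E] (Γ : AddSubgroup E) {f : ℂ → E}
    (hhol : DifferentiableOn ℂ f puncturedDisc) {k : ℕ} {d : ℕ → ℕ} {v : ℕ → E}
    (he : IsExpansion f k d v) (hF : (flag v k).restrictScalars ℝ ≤ realSpan Γ) :
    ∃ (W : Submodule ℝ E) (m : ℕ) (θ : ℂ → Fin m → ℝ) (φ : UnitAddTorus (Fin m) →+ E ⧸ Γ)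
      (s : ℂ → E), (flag v k).restrictScalars ℝ ≤ W ∧ W = Submodule.span ℝ ((Γ : Set E) ∩ W) ∧
      Continuous φ ∧ (Set.range fun t => proj Γ (v (k + 1)) + φ t) =
        proj Γ '' (AffineSubspace.mk' (v (k + 1)) W : Set E) ∧
      ContinuousOn θ puncturedDisc ∧
      HasPolarCharacters θ ∧
      Tendsto s (𝓝[≠] 0) (𝓝 0) ∧
      ∀ x, proj Γ (f x) = proj Γ (v (k + 1)) + φ (fun i => (θ x i : UnitAddCircle)) +
        proj Γ (s x) := by
  obtain ⟨W, m, b, l, hFW, hW, hbΓ, hbW, hlw, hl⟩ := exists_rational_frame Γ hF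
  -- `P` kills `W`, hence near `0` it sees only the remainder of `f - v_{k+1}`, which tends to `0`.
  let P : E →L[ℝ] E := ContinuousLinearMap.id ℝ E - ∑ i, (l i).smulRight (b i)
  have hP : ∀ u, P u = u - ∑ i, l i u • b i := fun u => by simp [P]
  refine ⟨W, m, fun x i => l i (f x - v (k + 1)), torusHom Γ b hbΓ,
    fun x => P (f x - v (k + 1)), hFW, hW, continuous_torusHom Γ b hbΓ,
    range_add_torusHom Γ b hbΓ _ hbW, ?_, ?_, ?_, ?_⟩
  · refine continuousOn_pi.2 fun i => ?_
    exact (l i).continuous.comp_continuousOn (hhol.continuousOn.sub continuousOn_const)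
  · intro n hn
    obtain ⟨u, hu, hu0⟩ := hl n hn
    have hξ : ∀ u, (∑ i, (n i : ℝ) • l i) u = ∑ i, (n i : ℝ) * l i u := fun u => by simp
    obtain ⟨Q, D, b, h1, h2, h3, h4, h5⟩ :=
      exists_character_pole hhol he (∑ i, (n i : ℝ) • l i) ⟨u, hu, by rwa [hξ]⟩
    exact ⟨Q, D, b, h1, h2, h3, h4, fun x => by rw [h5, hξ]⟩
  · obtain ⟨r, hr, hfr⟩ := he.exists_remainder
    have h1 : Tendsto (fun x => P (r x)) (𝓝[≠] 0) (𝓝 0) := by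
      have := (P.continuous.tendsto 0).comp hr
      rwa [map_zero] at this
    refine h1.congr' ?_
    filter_upwards [hfr] with x hx
    have h2 : P (f x - v (k + 1) - r x) = 0 := by
      rw [hP, hlw _ (hFW hx), sub_self]
    rw [map_sub, sub_eq_zero] at h2
    exact h2.symm
  · intro x
    rw [torusHom_coe]
    change _ = proj Γ (v (k + 1) + ∑ i, l i (f x - v (k + 1)) • b i + P (f x - v (k + 1)))
    rw [hP, add_add_sub_cancel, add_sub_cancel]

theorem mapClusterPt_add_of_tendsto_zero {X T : Type*} [AddCommGroup T] [TopologicalSpace T]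
    [IsTopologicalAddGroup T] {l : Filter X} {u s : X → T} {p : T} (hu : MapClusterPt p l u)
    (hs : Tendsto s l (𝓝 0)) : MapClusterPt p l fun x => u x + s x := by
  rw [mapClusterPt_iff_ultrafilter] at hu ⊢
  obtain ⟨V, hV, h⟩ := hu
  refine ⟨V, hV, ?_⟩
  simpa using h.add (hs.mono_left hV)

/-- If the curve avoided a neighbourhood of `t` near `0`, the averages of a bump supported there
would eventually vanish, whereas their limit is a positive Haar integral times the area of `U`. -/
theorem mapClusterPt_torus {m : ℕ} {θ : ℂ → Fin m → ℝ} (hθ : ContinuousOn θ puncturedDisc)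
    (hchar : HasPolarCharacters θ)
    (t : UnitAddTorus (Fin m)) :
    MapClusterPt t (𝓝[≠] (0 : ℂ)) fun x i => (θ x i : UnitAddCircle) := by
  rw [mapClusterPt_iff_frequently]
  intro N hN hcon
  obtain ⟨ε, hε, hεN⟩ := Metric.mem_nhds_iff.1 hN
  let g : UnitAddTorus (Fin m) → ℝ := fun s => max 0 (ε - dist s t)
  have hg : Continuous g := by fun_prop
  have hg0 : ∀ s, s ∉ N → g s = 0 := fun s hs => by
    refine max_eq_left ?_
    have : ¬ dist s t < ε := fun h => hs (hεN h)
    linarith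
  let G : C(UnitAddTorus (Fin m), ℂ) := ⟨fun s => (g s : ℂ), Complex.continuous_ofReal.comp hg⟩
  let U : Set ℂ := Metric.ball (1 / 2) (1 / 4)
  have hUD : closure U ⊆ puncturedDisc := by
    refine (closure_mono Metric.ball_subset_closedBall).trans ?_
    rw [Metric.isClosed_closedBall.closure_eq]
    intro x hx
    rw [Metric.mem_closedBall, dist_eq_norm] at hx
    constructor
    · rintro rfl
      norm_num at hx
    · have := norm_add_le (x - 1 / 2) (1 / 2)
      rw [sub_add_cancel] at this
      norm_num at this hx
      linarith
  have hlim := tendsto_setIntegral_torus hθ hchar Metric.isOpen_ball hUD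
    (ρ := fun _ => 1) contDiffOn_const G
  have hzero : ∀ᶠ a in 𝓝[≠] (0 : ℂ),
      (∫ y in U, G (fun i => (θ (a * y) i : UnitAddCircle)) * (1 : ℂ)) = 0 := by
    obtain ⟨δ, hδ, hb⟩ := Metric.mem_nhdsWithin_iff.1 (show {x | ¬ _} ∈ _ from hcon)
    filter_upwards [nhdsWithin_le_nhds (Metric.ball_mem_nhds (0 : ℂ) hδ), self_mem_nhdsWithin]
      with a ha ha0
    refine setIntegral_eq_zero_of_forall_eq_zero fun y hy => ?_
    have hyD := hUD (subset_closure hy)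
    have h1 : a * y ∈ Metric.ball (0 : ℂ) δ ∩ {0}ᶜ := by
      refine ⟨?_, mul_ne_zero ha0 hyD.1⟩
      rw [mem_ball_zero_iff] at ha ⊢
      rw [norm_mul]
      exact (mul_le_of_le_one_right (norm_nonneg _) hyD.2.le).trans_lt ha
    have h2 := hg0 _ (hb h1)
    rw [mul_one]
    change ((g _ : ℝ) : ℂ) = 0
    rw [h2, Complex.ofReal_zero]
  have h0 := tendsto_nhds_unique (hlim.congr' hzero) tendsto_const_nhds
  have hvol : ∫ _ in U, (1 : ℂ) ≠ 0 := by
    rw [setIntegral_const]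
    have : volume.real U ≠ 0 :=
      (ENNReal.toReal_pos (Metric.measure_ball_pos volume _ (by norm_num)).ne'
        measure_ball_lt_top.ne).ne'
    simpa using this
  have hpos : 0 < ∫ s, g s ∂(haarProb (UnitAddTorus (Fin m))) :=
    hg.integral_pos_of_hasCompactSupport_nonneg_nonzero (HasCompactSupport.of_compactSpace _)
      (fun s => le_max_left _ _) (x := t) (by simp [g, hε.ne', hε.le])
  have hG : ∫ s, G s ∂(haarProb (UnitAddTorus (Fin m))) =
      ((∫ s, g s ∂(haarProb (UnitAddTorus (Fin m))) : ℝ) : ℂ) := integral_ofReal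
  rw [hG] at h0
  rcases mul_eq_zero.1 h0 with h | h
  · exact hpos.ne' (by exact_mod_cast h)
  · exact hvol h

/-- For `u ∈ F`, each `c + t u` lies in `c' + W` up to some `γ t ∈ Γ`. As `ℝ` is uncountable and `Γ`
countable, two parameters share the same `γ`, and the difference puts `(t - t') u` in `W`. -/
theorem le_of_image_proj_subset (Γ : AddSubgroup E) [Countable Γ] {F W : Submodule ℝ E}
    {c c' : E} (h : proj Γ '' (AffineSubspace.mk' c F : Set E) ⊆
      proj Γ '' (AffineSubspace.mk' c' W : Set E)) : F ≤ W := by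
  intro u hu
  have hγ : ∀ t : ℝ, ∃ γ : Γ, c + t • u - γ - c' ∈ W := by
    intro t
    obtain ⟨w, hw, hwt⟩ := h ⟨c + t • u, by
      rw [SetLike.mem_coe, AffineSubspace.mem_mk', vsub_eq_sub, add_sub_cancel_left]
      exact F.smul_mem t hu, rfl⟩
    have hw' : -w + (c + t • u) ∈ Γ := QuotientAddGroup.eq.1 hwt
    rw [SetLike.mem_coe, AffineSubspace.mem_mk', vsub_eq_sub] at hw
    refine ⟨⟨_, hw'⟩, ?_⟩
    convert hw using 1
    simp only
    abel
  choose γ hγ using hγ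
  obtain ⟨t, t', hne, heq⟩ : ∃ t t' : ℝ, t ≠ t' ∧ γ t = γ t' := by
    by_contra! hcon
    have hinj : Function.Injective γ := fun t t' h => by
      by_contra hne
      exact hcon t t' hne h
    exact not_countable (α := ℝ) hinj.countable
  have h1 := W.sub_mem (hγ t) (hγ t')
  have h2 : c + t • u - γ t - c' - (c + t' • u - γ t' - c') = (t - t') • u := by
    rw [heq, sub_smul]; abel
  rw [h2] at h1
  have h3 := W.smul_mem (t - t')⁻¹ h1
  rwa [smul_smul, inv_mul_cancel₀ (sub_ne_zero.2 hne), one_smul] at h3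

theorem clusterSet_eq_of_parametrization {E : Type*} [NormedAddCommGroup E]
    (Γ : AddSubgroup E) [IsClosed (Γ : Set E)] {f : ℂ → E}
    {m : ℕ} {θ : ℂ → Fin m → ℝ} (hθ : ContinuousOn θ puncturedDisc)
    (hchar : HasPolarCharacters θ)
    {φ : UnitAddTorus (Fin m) →+ E ⧸ Γ} (hφ : Continuous φ) {p : E ⧸ Γ} {s : ℂ → E}
    (hs : Tendsto s (𝓝[≠] 0) (𝓝 0))
    (hf : ∀ x, proj Γ (f x) = p + φ (fun i => (θ x i : UnitAddCircle)) + proj Γ (s x)) :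
    clusterSet Γ f = Set.range fun t => p + φ t := by
  have hc : Continuous fun t => p + φ t := by fun_prop
  have hπ : Tendsto (fun x => proj Γ (s x)) (𝓝[≠] 0) (𝓝 0) :=
    ((continuous_quot_mk (r := (QuotientAddGroup.leftRel Γ))).tendsto 0).comp hs
  apply Set.Subset.antisymm
  · intro q hq
    have hq : MapClusterPt q (𝓝[≠] (0 : ℂ)) fun x => proj Γ (f x) := hq
    have h1 := mapClusterPt_add_of_tendsto_zero hq (by simpa using hπ.neg)
    rw [mapClusterPt_iff_ultrafilter] at h1
    obtain ⟨V, -, hV⟩ := h1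
    refine (isCompact_range hc).isClosed.mem_of_tendsto hV (Eventually.of_forall fun x => ?_)
    exact ⟨fun i => (θ x i : UnitAddCircle), by simp only [hf, add_neg_cancel_right]⟩
  · rintro _ ⟨t, rfl⟩
    have h1 := (mapClusterPt_torus hθ hchar t).continuousAt_comp hc.continuousAt
    have h2 := mapClusterPt_add_of_tendsto_zero h1 hπ
    change MapClusterPt _ _ _
    convert h2 using 2 with x
    exact hf x

/-- `f - r` takes values in `V` near `0` and `r → 0`; no condition relating `𝔽_k` to `Γ` enters. -/
theorem clusterSet_subset_closure (Γ : AddSubgroup E) {f : ℂ → E} {k : ℕ} {d : ℕ → ℕ}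
    {v : ℕ → E} (he : IsExpansion f k d v) :
    clusterSet Γ f ⊆ closure (proj Γ '' (affineV v k : Set E)) := by
  intro q hq
  obtain ⟨r, hr, hfr⟩ := he.exists_remainder
  have hπ : Tendsto (fun x => proj Γ (r x)) (𝓝[≠] 0) (𝓝 0) :=
    ((continuous_quot_mk (r := (QuotientAddGroup.leftRel Γ))).tendsto 0).comp hr
  have hq : MapClusterPt q (𝓝[≠] (0 : ℂ)) fun x => proj Γ (f x) := hq
  have h1 := mapClusterPt_add_of_tendsto_zero hq (by simpa using hπ.neg)
  rw [mapClusterPt_iff_ultrafilter] at h1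
  obtain ⟨V, hVl, hV⟩ := h1
  refine mem_closure_of_tendsto hV (hVl ?_)
  filter_upwards [hfr] with x hx
  refine ⟨f x - r x, ?_, ?_⟩
  · rw [SetLike.mem_coe, affineV, AffineSubspace.mem_mk', vsub_eq_sub]
    convert hx using 1
    abel
  · rw [← sub_eq_add_neg]
    rfl

/-- An ultrafilter on the punctured disc converges in the closed disc. A limit at `0` gives a
cluster value; any other limit gives a value of `π ∘ f` by continuity. -/
theorem closure_image_eq {E : Type*} [NormedAddCommGroup E]
    (Γ : AddSubgroup E) [IsClosed (Γ : Set E)] {f : ℂ → E}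
    (hcont : ContinuousOn f closedPuncturedDisc) :
    closure (proj Γ '' (f '' puncturedDisc)) =
      proj Γ '' (f '' closedPuncturedDisc) ∪ clusterSet Γ f := by
  have hcπ : ContinuousOn (fun x => proj Γ (f x)) closedPuncturedDisc :=
    (continuous_quot_mk (r := (QuotientAddGroup.leftRel Γ))).comp_continuousOn hcont
  rw [← Set.image_comp, ← Set.image_comp]
  apply Set.Subset.antisymm
  · intro q hq
    have hq' : MapClusterPt q (𝓟 puncturedDisc) (proj Γ ∘ f) := by
      rw [MapClusterPt, map_principal]
      exact mem_closure_iff_clusterPt.1 hq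
    rw [mapClusterPt_iff_ultrafilter] at hq'
    obtain ⟨V, hV, hVq⟩ := hq'
    have hVD : puncturedDisc ∈ V := hV (mem_principal_self _)
    have hVb : (V : Filter ℂ) ≤ 𝓟 (Metric.closedBall 0 1) := by
      rw [le_principal_iff]
      filter_upwards [hVD] with x hx using by simpa using hx.2.le
    obtain ⟨x, hx, hVx⟩ := (isCompact_closedBall (0 : ℂ) 1).ultrafilter_le_nhds V hVb
    by_cases hx0 : x = 0
    · right
      subst hx0
      refine mapClusterPt_iff_ultrafilter.2 ⟨V, le_inf hVx ?_, hVq⟩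
      rw [le_principal_iff]
      filter_upwards [hVD] with y hy using hy.1
    · left
      have hxD : x ∈ closedPuncturedDisc := ⟨hx0, by simpa using hx⟩
      refine ⟨x, hxD, ?_⟩
      have h1 : Tendsto (proj Γ ∘ f) V (𝓝 (proj Γ (f x))) := by
        refine (hcπ x hxD).mono_left (le_inf hVx ?_)
        rw [le_principal_iff]
        filter_upwards [hVD] with y hy using puncturedDisc_subset hy
      exact tendsto_nhds_unique h1 hVq
  · refine Set.union_subset ?_ ?_
    · rintro _ ⟨x, hx, rfl⟩
      have hxcl : x ∈ closure puncturedDisc := by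
        -- Radial approach from inside the disc; `n + 2` keeps the factor positive already at `n =
        -- 0`.
        have h1 : Tendsto (fun n : ℕ => ((1 - 1 / ((n : ℝ) + 2) : ℝ) : ℂ) * x) atTop
            (𝓝 (((1 - 0 : ℝ) : ℂ) * x)) := by
          have h2 : Tendsto (fun n : ℕ => 1 / ((n : ℝ) + 2)) atTop (𝓝 0) :=
            tendsto_const_nhds.div_atTop
              (tendsto_atTop_add_const_right _ _ tendsto_natCast_atTop_atTop)
          exact ((Complex.continuous_ofReal.tendsto _).comp
            (tendsto_const_nhds.sub h2)).mul_const x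
        rw [sub_zero, Complex.ofReal_one, one_mul] at h1
        refine mem_closure_of_tendsto h1 (Eventually.of_forall fun n => ?_)
        have h3 : (0 : ℝ) < 1 - 1 / ((n : ℝ) + 2) := by
          rw [sub_pos, div_lt_one (by positivity)]; linarith [n.cast_nonneg (α := ℝ)]
        have h4 : (1 - 1 / ((n : ℝ) + 2) : ℝ) < 1 := by
          rw [sub_lt_self_iff]; positivity
        refine ⟨mul_ne_zero (by exact_mod_cast h3.ne') hx.1, ?_⟩
        rw [norm_mul, Complex.norm_real, Real.norm_eq_abs, abs_of_pos h3]
        exact mul_lt_one_of_nonneg_of_lt_one_left h3.le h4 hx.2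
      exact ((hcπ x hx).mono puncturedDisc_subset).mem_closure_image hxcl
    · intro q hq
      have hq : MapClusterPt q (𝓝[≠] (0 : ℂ)) fun x => proj Γ (f x) := hq
      rw [mapClusterPt_iff_ultrafilter] at hq
      obtain ⟨V, hV, hVq⟩ := hq
      refine mem_closure_of_tendsto hVq (hV ?_)
      filter_upwards [puncturedDisc_mem_nhdsNE] with x hx using ⟨x, hx, rfl⟩

end OneDimFlow

/-! ### Rescaled area measures and their limit -/

namespace OneDimFlow

variable {E : Type*} [NormedAddCommGroup E] [InnerProductSpace ℂ E]

/-- The real differential sends `1` and `i` to `f'` and `i f'`, and `Im ⟨f', i f'⟩ = ‖f'‖²`. -/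
theorem pullbackDensity_eq {f : ℂ → E} (hhol : DifferentiableOn ℂ f puncturedDisc) {x : ℂ}
    (hx : x ∈ puncturedDisc) : pullbackDensity f x = 2 * ‖deriv f x‖ ^ 2 := by
  have h1 : DifferentiableAt ℂ f x := hhol.differentiableAt (isOpen_puncturedDisc.mem_nhds hx)
  have h2 : fderiv ℝ f x = (fderiv ℂ f x).restrictScalars ℝ :=
    (h1.hasFDerivAt.restrictScalars ℝ).fderiv
  have h3 : fderiv ℝ f x 1 = deriv f x := by rw [h2]; exact fderiv_apply_one_eq_deriv
  have h4 : fderiv ℝ f x Complex.I = Complex.I • deriv f x := by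
    rw [h2]; exact fderiv_eq_smul_deriv Complex.I
  rw [pullbackDensity, h3, h4, kahlerForm, inner_smul_right, inner_self_eq_norm_sq_to_K]
  congr 1
  have h5 : ((‖deriv f x‖ : ℂ) ^ 2).re = ‖deriv f x‖ ^ 2 := by
    rw [← Complex.ofReal_pow, Complex.ofReal_re]
  rw [Complex.I_mul_im]
  exact h5

theorem setIntegral_image_mul {a : ℂ} (ha : a ≠ 0) {U : Set ℂ} (hU : MeasurableSet U)
    (h : ℂ → ℝ) : ∫ x in (fun x => a * x) '' U, h x = ‖a‖ ^ 2 * ∫ y in U, h (a * y) := by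
  have h1 := integral_image_eq_integral_abs_det_fderiv_smul volume hU
    (f := fun x => a * x) (f' := fun _ => ContinuousLinearMap.mul ℝ ℂ a)
    (fun x _ => (ContinuousLinearMap.mul ℝ ℂ a).hasFDerivAt.hasFDerivWithinAt)
    (mul_right_injective₀ ha).injOn h
  have h2 : (ContinuousLinearMap.mul ℝ ℂ a).det = ‖a‖ ^ 2 := by
    rw [← Complex.normSq_eq_norm_sq, ← Algebra.norm_complex_apply]
    rfl
  rw [h1, h2, abs_of_nonneg (by positivity), ← integral_const_mul]
  rfl

/-- The Jacobian `|a|²` of `y ↦ a y` joins the normalization `|a|^{2D}` to form `‖a^{D+1} f'(a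
y)‖²`. -/
theorem integral_mu [FiniteDimensional ℂ E] [MeasurableSpace E] [BorelSpace E] (Γ : AddSubgroup E)
    [IsClosed (Γ : Set E)] {f : ℂ → E} (hhol : DifferentiableOn ℂ f puncturedDisc) (D : ℕ) (w : E)
    {U : Set ℂ} (hU : IsOpen U) (hUD : closure U ⊆ puncturedDisc) {a : ℂ}
    (ha : a ∈ puncturedDisc) (hl : 0 ≤ lambdaZero U D w) (g : (E ⧸ Γ) →ᵇ ℝ) :
    ∫ t, g t ∂(mu Γ f D w U a) = (lambdaZero U D w)⁻¹ *
      ∫ y in U, g (proj Γ (f (a * y))) * (2 * ‖a ^ (D + 1) • deriv f (a * y)‖ ^ 2) := by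
  have : CompleteSpace E := FiniteDimensional.complete ℂ E
  have : ProperSpace E := FiniteDimensional.proper ℂ E
  have hU' : ∀ y ∈ U, a * y ∈ puncturedDisc := fun y hy =>
    mul_mem_puncturedDisc ha (hUD (subset_closure hy))
  set W : Set ℂ := (fun x => a * x) '' U with hW
  have hWD : W ⊆ puncturedDisc := by
    rintro _ ⟨y, hy, rfl⟩
    exact hU' y hy
  have hWo : IsOpen W := (Homeomorph.mulLeft₀ a ha.1).isOpenMap U hU
  have hfm : AEMeasurable f
      ((volume.restrict W).withDensity fun x => ENNReal.ofReal (pullbackDensity f x)) :=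
    ((hhol.continuousOn.mono hWD).aemeasurable hWo.measurableSet).mono_ac
      (withDensity_absolutelyContinuous _ _)
  have hπ : Continuous (proj Γ) := continuous_quot_mk
  have hdm : AEMeasurable (fun x => ENNReal.ofReal (pullbackDensity f x)) (volume.restrict W) := by
    have h1 : ContinuousOn (fun x => 2 * ‖deriv f x‖ ^ 2) W :=
      continuousOn_const.mul
        (((hhol.deriv isOpen_puncturedDisc).continuousOn.mono hWD).norm.pow 2)
    have h2 : AEMeasurable (fun x => pullbackDensity f x) (volume.restrict W) := by
      refine (h1.aemeasurable hWo.measurableSet).congr ?_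
      filter_upwards [ae_restrict_mem hWo.measurableSet] with x hx
      exact (pullbackDensity_eq hhol (hWD hx)).symm
    exact h2.ennreal_ofReal
  have hmap := integral_map (f := fun x => g (proj Γ x)) hfm
    (g.continuous.comp hπ).aestronglyMeasurable
  rw [mu, integral_smul_measure, areaMeasure, integral_map hπ.aemeasurable
    g.continuous.aestronglyMeasurable, hmap,
    integral_withDensity_eq_integral_toReal_smul₀ hdm (by simp)]
  have h3 : ∫ x in W, (ENNReal.ofReal (pullbackDensity f x)).toReal • g (proj Γ (f x)) =
      ∫ x in W, g (proj Γ (f x)) * (2 * ‖deriv f x‖ ^ 2) := by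
    refine setIntegral_congr_fun hWo.measurableSet fun x hx => ?_
    rw [pullbackDensity_eq hhol (hWD hx), ENNReal.toReal_ofReal (by positivity), smul_eq_mul,
      mul_comm]
  rw [h3, setIntegral_image_mul ha.1 hU.measurableSet, ENNReal.toReal_ofReal (by positivity),
    smul_eq_mul, mul_assoc, ← integral_const_mul, ← integral_const_mul]
  congr 2
  funext y
  rw [norm_smul, norm_pow]
  ring

/-- `E ⧸ Γ` need not be compact and `g` need not be uniformly continuous, but `q` stays in a compact
set, so it converges along every ultrafilter. -/
theorem tendsto_sub_of_compact {X T : Type*} [AddCommGroup T] [TopologicalSpace T]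
    [IsTopologicalAddGroup T] {l : Filter X} {K : Set T} (hK : IsCompact K) {q z : X → T}
    (hq : ∀ x, q x ∈ K) (hz : Tendsto z l (𝓝 0)) {g : T → ℝ} (hg : Continuous g) :
    Tendsto (fun x => g (q x + z x) - g (q x)) l (𝓝 0) := by
  rw [tendsto_iff_ultrafilter]
  intro V hV
  obtain ⟨p, -, hp⟩ := hK.ultrafilter_le_nhds (V.map q) (by
    rw [le_principal_iff]
    exact Ultrafilter.mem_map.2 (Filter.univ_mem' hq))
  have hp : Tendsto q V (𝓝 p) := hp
  have h1 : Tendsto (fun x => q x + z x) V (𝓝 p) := by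
    simpa using hp.add (hz.mono_left hV)
  simpa using ((hg.tendsto p).comp h1).sub ((hg.tendsto p).comp hp)

/-- The density `2 D² ‖w‖² |y|^{-2D-2}` of the limit area form. -/
noncomputable def limitDensity (D : ℕ) (w : E) (y : ℂ) : ℝ :=
  (D : ℝ) ^ 2 * ‖w‖ ^ 2 * ((‖y‖ ^ (2 * D + 2))⁻¹ * 2)

theorem contDiffOn_limitDensity {E : Type*} [NormedAddCommGroup E] (D : ℕ) (w : E) :
    ContDiffOn ℝ 1 (limitDensity D w) {0}ᶜ := by
  intro y hy
  have hy : y ≠ 0 := hy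
  have h1 : ContDiffAt ℝ 1 (fun y : ℂ => ‖y‖) y := contDiffAt_norm ℝ hy
  exact (contDiffAt_const.mul (((h1.pow _).inv (by positivity)).mul
    contDiffAt_const)).contDiffWithinAt

theorem setIntegral_limitDensity {E : Type*} [NormedAddCommGroup E] (U : Set ℂ) (D : ℕ) (w : E) :
    ∫ y in U, limitDensity D w y = lambdaZero U D w := by
  simp only [limitDensity, lambdaZero, integral_const_mul]

theorem integrableOn_of_continuousOn {U : Set ℂ} (hUD : closure U ⊆ puncturedDisc) {ρ : ℂ → ℝ}
    (hρ : ContinuousOn ρ {0}ᶜ) : IntegrableOn ρ U :=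
  ((hρ.mono fun _ hx => (hUD hx).1).integrableOn_compact
    (isCompact_closure_of_subset hUD)).mono_set subset_closure

theorem lambdaZero_pos {E : Type*} [NormedAddCommGroup E] {U : Set ℂ} (hU : IsOpen U)
    (hne : U.Nonempty)
    (hUD : closure U ⊆ puncturedDisc) {D : ℕ} (hD : D ≠ 0) {w : E} (hw : w ≠ 0) :
    0 < lambdaZero U D w := by
  rw [← setIntegral_limitDensity]
  have hpos : ∀ y ∈ U, 0 < limitDensity D w y := fun y hy => by
    have h1 := norm_pos_iff.2 (hUD (subset_closure hy)).1
    have h2 := norm_pos_iff.2 hw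
    have h3 : (0 : ℝ) < D := by exact_mod_cast Nat.pos_of_ne_zero hD
    unfold limitDensity
    positivity
  rw [setIntegral_pos_iff_support_of_nonneg_ae]
  · have : Function.support (limitDensity D w) ∩ U = U :=
      Set.inter_eq_right.2 fun y hy => (hpos y hy).ne'
    rw [this]
    exact hU.measure_pos volume hne
  · filter_upwards [ae_restrict_mem hU.measurableSet] with y hy using (hpos y hy).le
  · exact integrableOn_of_continuousOn hUD (contDiffOn_limitDensity D w).continuousOn

theorem tendsto_mul_nhdsNE {y : ℂ} (hy : y ≠ 0) :
    Tendsto (fun a : ℂ => a * y) (𝓝[≠] 0) (𝓝[≠] 0) := by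
  refine tendsto_nhdsWithin_iff.2 ⟨?_, ?_⟩
  · have : Tendsto (fun a : ℂ => a * y) (𝓝 0) (𝓝 (0 * y)) :=
      (continuous_mul_const y).tendsto 0
    rw [zero_mul] at this
    exact this.mono_left nhdsWithin_le_nhds
  · filter_upwards [self_mem_nhdsWithin] with a ha using mul_ne_zero ha hy

/-- The rescaled area densities may be replaced by their limit, and `π ∘ f` by a curve
asymptotic to it, without changing the limit of the averages. -/
theorem tendsto_setIntegral_sub [FiniteDimensional ℂ E] (Γ : AddSubgroup E) {f : ℂ → E}
    (hhol : DifferentiableOn ℂ f puncturedDisc) {D : ℕ} {w : E}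
    (hlim : Tendsto (fun x => x ^ D • f x) (𝓝[≠] 0) (𝓝 w))
    {q : ℂ → E ⧸ Γ} (hq : ContinuousOn q puncturedDisc) {K : Set (E ⧸ Γ)} (hK : IsCompact K)
    (hqK : ∀ x, q x ∈ K) {s : ℂ → E} (hs : Tendsto s (𝓝[≠] 0) (𝓝 0))
    (hf : ∀ x, proj Γ (f x) = q x + proj Γ (s x))
    {U : Set ℂ} (hU : IsOpen U) (hUD : closure U ⊆ puncturedDisc) (g : (E ⧸ Γ) →ᵇ ℝ) :
    Tendsto (fun a : ℂ => ∫ y in U,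
      (g (proj Γ (f (a * y))) * (2 * ‖a ^ (D + 1) • deriv f (a * y)‖ ^ 2) -
        g (q (a * y)) * limitDensity D w y)) (𝓝[≠] 0) (𝓝 0) := by
  have : CompleteSpace E := FiniteDimensional.complete ℂ E
  have hd := tendsto_pow_smul_deriv hhol hlim
  have hπ : Continuous (proj Γ) := continuous_quot_mk
  have hcf' := (hhol.deriv isOpen_puncturedDisc).continuousOn
  -- Bounds `‖x^{D+1} f'(x)‖` near `0`, hence at every `x = a y` with `a` small, since `|y| < 1` on
  -- `U`.
  set C : ℝ := ‖-(D : ℂ) • w‖ + 1 with hC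
  have hbd : ∀ᶠ x in 𝓝[≠] (0 : ℂ), ‖x ^ (D + 1) • deriv f x‖ < C :=
    hd.norm.eventually_lt_const (lt_add_one _)
  obtain ⟨δ, hδ, hb⟩ := Metric.mem_nhdsWithin_iff.1 hbd
  have hy0 : ∀ y ∈ U, y ≠ 0 := fun y hy => (hUD (subset_closure hy)).1
  have hinv : ContinuousOn (fun y : ℂ => (‖y‖ ^ (2 * D + 2))⁻¹) {0}ᶜ := fun y hy =>
    ((continuousAt_id.norm.pow _).inv₀
      (pow_ne_zero _ (norm_ne_zero_iff.2 hy))).continuousWithinAt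
  have hρ := (contDiffOn_limitDensity D w).continuousOn
  have hρ0 : ∀ y, 0 ≤ limitDensity D w y := fun y => by unfold limitDensity; positivity
  -- rewriting the rescaled density
  have hB : ∀ a : ℂ, ∀ y : ℂ, y ≠ 0 → 2 * ‖a ^ (D + 1) • deriv f (a * y)‖ ^ 2 =
      2 * ‖(a * y) ^ (D + 1) • deriv f (a * y)‖ ^ 2 * (‖y‖ ^ (2 * D + 2))⁻¹ := by
    intro a y hy
    have := norm_ne_zero_iff.2 hy
    rw [mul_pow, norm_smul, norm_smul, norm_mul, norm_pow, norm_pow]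
    field_simp
    ring
  have key := tendsto_integral_filter_of_dominated_convergence (μ := volume.restrict U)
    (l := 𝓝[≠] (0 : ℂ)) (f := fun _ => (0 : ℝ))
    (F := fun a y => g (proj Γ (f (a * y))) * (2 * ‖a ^ (D + 1) • deriv f (a * y)‖ ^ 2) -
        g (q (a * y)) * limitDensity D w y)
    (fun y => ‖g‖ * (2 * C ^ 2 * (‖y‖ ^ (2 * D + 2))⁻¹) + ‖g‖ * limitDensity D w y) ?_ ?_ ?_ ?_
  · simpa using key
  · filter_upwards [puncturedDisc_mem_nhdsNE] with a ha
    refine ContinuousOn.aestronglyMeasurable ?_ hU.measurableSet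
    have hmaps : Set.MapsTo (fun y => a * y) U puncturedDisc := fun y hy =>
      mul_mem_puncturedDisc ha (hUD (subset_closure hy))
    have hm : ContinuousOn (fun y => a * y) U := by fun_prop
    have c1 : ContinuousOn (fun y => g (proj Γ (f (a * y)))) U :=
      (g.continuous.comp hπ).comp_continuousOn (hhol.continuousOn.comp hm hmaps)
    have c2 : ContinuousOn (fun y => deriv f (a * y)) U := hcf'.comp hm hmaps
    have c3 : ContinuousOn (fun y => g (q (a * y))) U :=
      g.continuous.comp_continuousOn (hq.comp hm hmaps)
    exact (c1.mul (continuousOn_const.mul ((c2.const_smul _).norm.pow 2))).sub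
      (c3.mul (hρ.mono hy0))
  · filter_upwards [nhdsWithin_le_nhds (Metric.ball_mem_nhds (0 : ℂ) hδ), self_mem_nhdsWithin]
      with a ha ha0
    filter_upwards [ae_restrict_mem hU.measurableSet] with y hy
    have hyD := hUD (subset_closure hy)
    have h1 : ‖(a * y) ^ (D + 1) • deriv f (a * y)‖ < C := by
      refine hb ⟨?_, mul_ne_zero ha0 hyD.1⟩
      rw [mem_ball_zero_iff] at ha ⊢
      rw [norm_mul]
      exact (mul_le_of_le_one_right (norm_nonneg _) hyD.2.le).trans_lt ha
    refine (norm_sub_le _ _).trans (add_le_add ?_ ?_)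
    · rw [hB a y hyD.1, norm_mul]
      refine mul_le_mul (g.norm_coe_le_norm _) ?_ (norm_nonneg _) (norm_nonneg _)
      rw [Real.norm_of_nonneg (by positivity)]
      gcongr
    · rw [norm_mul, Real.norm_of_nonneg (hρ0 y)]
      exact mul_le_mul_of_nonneg_right (g.norm_coe_le_norm _) (hρ0 y)
  · refine Integrable.add ?_ ?_
    · exact integrableOn_of_continuousOn hUD
        (continuousOn_const.mul (continuousOn_const.mul hinv))
    · exact integrableOn_of_continuousOn hUD (continuousOn_const.mul hρ)
  · filter_upwards [ae_restrict_mem hU.measurableSet] with y hy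
    have ht := tendsto_mul_nhdsNE (hy0 y hy)
    have h1 : Tendsto (fun a => g (proj Γ (f (a * y))) - g (q (a * y))) (𝓝[≠] 0) (𝓝 0) := by
      have hz : Tendsto (fun a => proj Γ (s (a * y))) (𝓝[≠] 0) (𝓝 0) :=
        (hπ.tendsto 0).comp (hs.comp ht)
      have := tendsto_sub_of_compact hK (fun a => hqK (a * y)) hz g.continuous
      refine this.congr fun a => ?_
      rw [hf]
    have h2 : Tendsto (fun a => 2 * ‖a ^ (D + 1) • deriv f (a * y)‖ ^ 2) (𝓝[≠] 0)
        (𝓝 (limitDensity D w y)) := by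
      have h3 := (((hd.comp ht).norm.pow 2).const_mul 2).mul_const (‖y‖ ^ (2 * D + 2))⁻¹
      have h4 : 2 * ‖-(D : ℂ) • w‖ ^ 2 * (‖y‖ ^ (2 * D + 2))⁻¹ = limitDensity D w y := by
        rw [limitDensity, norm_smul, norm_neg, Complex.norm_natCast]
        ring
      rw [h4] at h3
      exact h3.congr fun a => (hB a y (hy0 y hy)).symm
    -- Second half of the splitting `A B - A' B' = (A - A') B + A' (B - B')`.
    have h5 : Tendsto (fun a => g (q (a * y)) *
        (2 * ‖a ^ (D + 1) • deriv f (a * y)‖ ^ 2 - limitDensity D w y)) (𝓝[≠] 0) (𝓝 0) := by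
      refine bdd_le_mul_tendsto_zero' ‖g‖ (Eventually.of_forall fun a => g.norm_coe_le_norm _) ?_
      simpa using h2.sub_const (limitDensity D w y)
    have h6 := (h1.mul h2).add h5
    rw [zero_mul, add_zero] at h6
    refine h6.congr fun a => ?_
    ring

theorem tendsto_integral_mu [FiniteDimensional ℂ E] [MeasurableSpace E] [BorelSpace E]
    (Γ : AddSubgroup E) [IsClosed (Γ : Set E)] {f : ℂ → E}
    (hhol : DifferentiableOn ℂ f puncturedDisc) {D : ℕ} (hD : D ≠ 0) {w : E} (hw : w ≠ 0)
    (hlim : Tendsto (fun x => x ^ D • f x) (𝓝[≠] 0) (𝓝 w))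
    {m : ℕ} {θ : ℂ → Fin m → ℝ} (hθ : ContinuousOn θ puncturedDisc)
    (hchar : HasPolarCharacters θ)
    {φ : UnitAddTorus (Fin m) →+ E ⧸ Γ} (hφ : Continuous φ) {p : E ⧸ Γ} {s : ℂ → E}
    (hs : Tendsto s (𝓝[≠] 0) (𝓝 0))
    (hf : ∀ x, proj Γ (f x) = p + φ (fun i => (θ x i : UnitAddCircle)) + proj Γ (s x))
    {U : Set ℂ} (hU : IsOpen U) (hne : U.Nonempty) (hUD : closure U ⊆ puncturedDisc)
    (g : (E ⧸ Γ) →ᵇ ℝ) :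
    Tendsto (fun a : ℂ => ∫ t, g t ∂(mu Γ f D w U a)) (𝓝[≠] 0)
      (𝓝 (∫ t, g t ∂((haarProb (UnitAddTorus (Fin m))).map fun t => p + φ t))) := by
  have : ProperSpace E := FiniteDimensional.proper ℂ E
  have : CompleteSpace E := FiniteDimensional.complete ℂ E
  have hlam := lambdaZero_pos hU hne hUD hD hw
  have hc : Continuous fun t => p + φ t := by fun_prop
  have hcoe : Continuous fun t : Fin m → ℝ => fun i => (t i : UnitAddCircle) :=
    continuous_pi fun i => (AddCircle.continuous_mk' 1).comp (continuous_apply i)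
  let q : ℂ → E ⧸ Γ := fun x => p + φ (fun i => (θ x i : UnitAddCircle))
  have hq : ContinuousOn q puncturedDisc := (hc.comp hcoe).comp_continuousOn hθ
  have hsub := tendsto_setIntegral_sub Γ hhol hlim hq (isCompact_range hc)
    (fun x => ⟨fun i => (θ x i : UnitAddCircle), rfl⟩) hs hf hU hUD g
  have hρc : ContDiffOn ℝ 1 (fun y => (limitDensity D w y : ℂ)) {0}ᶜ :=
    Complex.ofRealCLM.contDiff.comp_contDiffOn (contDiffOn_limitDensity D w)
  let G : C(UnitAddTorus (Fin m), ℂ) := ⟨fun t => (g (p + φ t) : ℂ),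
    Complex.continuous_ofReal.comp (g.continuous.comp hc)⟩
  have hG := tendsto_setIntegral_torus hθ hchar hU hUD hρc G
  have hG' : Tendsto (fun a : ℂ => ∫ y in U, g (q (a * y)) * limitDensity D w y) (𝓝[≠] 0)
      (𝓝 ((∫ t, g (p + φ t) ∂(haarProb (UnitAddTorus (Fin m)))) * lambdaZero U D w)) := by
    have h1 := (Complex.continuous_re.tendsto _).comp hG
    have h2 : (∫ t, G t ∂(haarProb (UnitAddTorus (Fin m)))) =
        ((∫ t, g (p + φ t) ∂(haarProb (UnitAddTorus (Fin m))) : ℝ) : ℂ) := integral_ofReal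
    have h3 : (∫ y in U, (limitDensity D w y : ℂ)) = ((lambdaZero U D w : ℝ) : ℂ) := by
      rw [← setIntegral_limitDensity]
      exact integral_ofReal
    rw [h2, h3, ← Complex.ofReal_mul, Complex.ofReal_re] at h1
    refine h1.congr fun a => ?_
    have h4 : (∫ y in U, G (fun i => (θ (a * y) i : UnitAddCircle)) * (limitDensity D w y : ℂ)) =
        ((∫ y in U, g (q (a * y)) * limitDensity D w y : ℝ) : ℂ) := by
      refine Eq.trans ?_ integral_ofReal
      congr 1
      funext y
      exact (Complex.ofReal_mul _ _).symm
    simp only [Function.comp, h4, Complex.ofReal_re]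
  rw [integral_map hc.aemeasurable g.continuous.aestronglyMeasurable]
  have htot := (hsub.add hG').const_mul (lambdaZero U D w)⁻¹
  rw [zero_add, mul_comm (∫ t, g (p + φ t) ∂_), inv_mul_cancel_left₀ hlam.ne'] at htot
  refine htot.congr' ?_
  filter_upwards [puncturedDisc_mem_nhdsNE] with a ha
  rw [integral_mu Γ hhol D w hU hUD ha hlam.le]
  congr 1
  have hmaps : Set.MapsTo (fun y => a * y) (closure U) puncturedDisc := fun y hy =>
    mul_mem_puncturedDisc ha (hUD hy)
  have hm : ContinuousOn (fun y => a * y) (closure U) := by fun_prop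
  have hKU := isCompact_closure_of_subset hUD
  have hπ : Continuous (proj Γ) := continuous_quot_mk
  have i1 : IntegrableOn (fun y => g (proj Γ (f (a * y))) *
      (2 * ‖a ^ (D + 1) • deriv f (a * y)‖ ^ 2)) U := by
    refine (ContinuousOn.integrableOn_compact hKU ?_).mono_set subset_closure
    have c1 : ContinuousOn (fun y => g (proj Γ (f (a * y)))) (closure U) :=
      (g.continuous.comp hπ).comp_continuousOn (hhol.continuousOn.comp hm hmaps)
    have c2 : ContinuousOn (fun y => deriv f (a * y)) (closure U) :=
      (hhol.deriv isOpen_puncturedDisc).continuousOn.comp hm hmaps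
    exact c1.mul (continuousOn_const.mul ((c2.const_smul _).norm.pow 2))
  have i2 : IntegrableOn (fun y => g (q (a * y)) * limitDensity D w y) U := by
    refine (ContinuousOn.integrableOn_compact hKU ?_).mono_set subset_closure
    exact (g.continuous.comp_continuousOn (hq.comp hm hmaps)).mul
      ((contDiffOn_limitDensity D w).continuousOn.mono fun y hy => (hUD hy).1)
  rw [integral_sub i1 i2, sub_add_cancel]

end OneDimFlow

/-! ### Assembly of the main theorem -/

theorem theorem2p7 {E : Type*} [NormedAddCommGroup E] [InnerProductSpace ℂ E]
    [FiniteDimensional ℂ E] [MeasurableSpace E] [BorelSpace E]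
    (Γ : AddSubgroup E) [DiscreteTopology Γ] (f : ℂ → E)
    (hsmooth : ContDiffOn ℝ ∞ f OneDimFlow.closedPuncturedDisc)
    (hhol : DifferentiableOn ℂ f OneDimFlow.puncturedDisc)
    (hgrowth : OneDimFlow.HasPolynomialGrowth f)
    (hunbounded : ¬ Bornology.IsBounded (f '' OneDimFlow.closedPuncturedDisc)) :
    (∃ (k : ℕ) (d : ℕ → ℕ) (v : ℕ → E), OneDimFlow.IsExpansion f k d v) ∧
    ∀ (k : ℕ) (d : ℕ → ℕ) (v : ℕ → E), OneDimFlow.IsExpansion f k d v →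
      ((OneDimFlow.flag v k).restrictScalars ℝ ≤ OneDimFlow.realSpan Γ ↔
        OneDimFlow.IsTranslatedSubtorus Γ
          (closure (OneDimFlow.proj Γ '' (OneDimFlow.affineV v k : Set E)))) ∧
      ((OneDimFlow.flag v k).restrictScalars ℝ ≤ OneDimFlow.realSpan Γ →
        (∃ μV : Measure (E ⧸ Γ),
          OneDimFlow.IsHaarProbabilityOn μV
            (closure (OneDimFlow.proj Γ '' (OneDimFlow.affineV v k : Set E))) ∧
          (∀ ν : Measure (E ⧸ Γ), OneDimFlow.IsHaarProbabilityOn ν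
            (closure (OneDimFlow.proj Γ '' (OneDimFlow.affineV v k : Set E))) → ν = μV) ∧
          ∀ U : Set ℂ, IsOpen U → IsConnected U → closure U ⊆ OneDimFlow.puncturedDisc →
            ∀ g : (E ⧸ Γ) →ᵇ ℝ,
              Tendsto (fun a : ℂ => ∫ t, g t ∂(OneDimFlow.mu Γ f (d 1) (v 1) U a))
                (𝓝[≠] (0 : ℂ)) (𝓝 (∫ t, g t ∂μV))) ∧
        OneDimFlow.clusterSet Γ f =
          closure (OneDimFlow.proj Γ '' (OneDimFlow.affineV v k : Set E)) ∧
        closure (OneDimFlow.proj Γ '' (f '' OneDimFlow.puncturedDisc)) =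
          OneDimFlow.proj Γ '' (f '' OneDimFlow.closedPuncturedDisc) ∪
            closure (OneDimFlow.proj Γ '' (OneDimFlow.affineV v k : Set E))) := by
  open OneDimFlow in
  have : CompleteSpace E := FiniteDimensional.complete ℂ E
  have : ProperSpace E := FiniteDimensional.proper ℂ E
  have hΓcl : IsClosed (Γ : Set E) := AddSubgroup.isClosed_of_discrete
  have hcont : ContinuousOn f closedPuncturedDisc := hsmooth.continuousOn
  refine ⟨exists_isExpansion hcont hhol hgrowth hunbounded, fun k d v he => ?_⟩
  have hset : (affineV v k : Set E) =
      (AffineSubspace.mk' (v (k + 1)) ((flag v k).restrictScalars ℝ) : Set E) := by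
    ext x
    simp [affineV, AffineSubspace.mem_mk']
  -- the closure of `π(V)` when `F_k ⊆ Γ_ℝ`
  have hclosure : ∀ (W : Submodule ℝ E) (m : ℕ) (φ : UnitAddTorus (Fin m) →+ E ⧸ Γ),
      (flag v k).restrictScalars ℝ ≤ W → Continuous φ →
      (Set.range fun t => proj Γ (v (k + 1)) + φ t) =
        proj Γ '' (AffineSubspace.mk' (v (k + 1)) W : Set E) →
      clusterSet Γ f = (Set.range fun t => proj Γ (v (k + 1)) + φ t) →
      closure (proj Γ '' (affineV v k : Set E)) =
        Set.range fun t => proj Γ (v (k + 1)) + φ t := by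
    intro W m φ hFW hφ hrange hcl
    have hc : Continuous fun t => proj Γ (v (k + 1)) + φ t := by fun_prop
    -- One inclusion holds because `𝔽_k ⊆ W`; the other because the torus consists of cluster values
    -- of `π ∘ f`, which lie in the closure of `π(V)`.
    refine Set.Subset.antisymm (closure_minimal ?_ (isCompact_range hc).isClosed) ?_
    · rw [hrange, hset]
      refine Set.image_mono fun x hx => ?_
      rw [SetLike.mem_coe, AffineSubspace.mem_mk'] at hx ⊢
      exact hFW hx
    · rw [← hcl]
      exact clusterSet_subset_closure Γ he
  refine ⟨⟨fun hF => ?_, ?_⟩, fun hF => ?_⟩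
  · obtain ⟨W, m, θ, φ, s, hFW, hW, hφ, hrange, hθ, hchar, hs, hf⟩ :=
      exists_torus_parametrization Γ hhol he hF
    have hcl := clusterSet_eq_of_parametrization Γ hθ hchar hφ hs hf
    refine ⟨v (k + 1), W, hW, ?_⟩
    rw [hclosure W m φ hFW hφ hrange hcl, hrange]
  · rintro ⟨c, W, hW, hS⟩
    have : Countable Γ := countable_of_Lindelof_of_discrete
    have hFW : (flag v k).restrictScalars ℝ ≤ W := by
      refine le_of_image_proj_subset Γ (c := v (k + 1)) (c' := c) ?_
      rw [← hS, ← hset]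
      exact subset_closure
    refine hFW.trans ?_
    rw [hW]
    exact Submodule.span_mono Set.inter_subset_left
  · obtain ⟨W, m, θ, φ, s, hFW, hW, hφ, hrange, hθ, hchar, hs, hf⟩ :=
      exists_torus_parametrization Γ hhol he hF
    have hcl := clusterSet_eq_of_parametrization Γ hθ hchar hφ hs hf
    have hclos := hclosure W m φ hFW hφ hrange hcl
    have h1k : 1 ∈ Finset.Icc 1 k := Finset.mem_Icc.2 ⟨le_rfl, he.one_le⟩
    have hv1 : v 1 ≠ 0 := he.linearIndep.ne_zero ⟨le_rfl, he.one_le⟩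
    have hd1 : d 1 ≠ 0 := (he.zero_lt h1k).ne'
    have hlim : Tendsto (fun x => x ^ d 1 • f x) (𝓝[≠] 0) (𝓝 (v 1)) := by
      have h1 := he.tendsto_pow_smul (ContinuousLinearMap.id ℂ E) h1k
        (fun j hj hj1 => absurd (Finset.mem_Icc.1 hj).1 (by omega))
      have h2 : Tendsto (fun x : ℂ => x ^ d 1 • v (k + 1)) (𝓝[≠] 0) (𝓝 0) := by
        have h3 : Tendsto (fun x : ℂ => x ^ d 1) (𝓝[≠] 0) (𝓝 (0 ^ d 1)) :=
          ((continuous_pow _).tendsto 0).mono_left nhdsWithin_le_nhds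
        rw [zero_pow hd1] at h3
        simpa using h3.smul_const (v (k + 1))
      have h4 := h1.add h2
      simp only [ContinuousLinearMap.id_apply, add_zero, ← smul_add, sub_add_cancel] at h4
      exact h4
    refine ⟨⟨(haarProb (UnitAddTorus (Fin m))).map fun t => proj Γ (v (k + 1)) + φ t,
      ?_, ?_, ?_⟩, ?_, ?_⟩
    · rw [hclos]
      exact isHaarProbabilityOn_map φ hφ _
    · intro ν hν
      rw [hclos] at hν
      exact isHaarProbabilityOn_unique φ hφ _ hν
    · intro U hU hUc hUD g
      exact tendsto_integral_mu Γ hhol hd1 hv1 hlim hθ hchar hφ hs hf hU hUc.nonempty hUD g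
    · rw [hcl, hclos]
    · rw [closure_image_eq Γ hcont, hcl, hclos]
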